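/- Let $r=\sqrt{\sec(\pi/5)}$ and, for $i=1,\dots,5$, $\omega_i=(r\cos\frac{2\pi i}{5},\,r\sin\frac{2\pi i}{5},\,1)^{\mathrm T}\in\mathbb R^3$. The pentagon system has normalized state space $\Omega=\mathrm{conv}\{\omega_1,\dots,\omega_5\}$, effect space $\mathcal E=\{e\in\mathbb R^3: 0\le e^{\mathrm T}\omega\le 1\ \text{for all}\ \omega\in\Omega\}$, unit effect $u=(0,0,1)^{\mathrm T}$, and as reversible transformations the ten matrices $$\mathcal T_k^s=\begin{pmatrix}\cos\frac{2\pi k}{5}&-s\sin\frac{2\pi k}{5}&0\\ \sin\frac{2\pi k}{5}&s\cos\frac{2\pi k}{5}&0\\0&0&1\end{pmatrix},\qquad k\in\{1,\dots,5\},\ s\in\{1,-1\}.$$ Identify $\mathbb R^3\otimes\mathbb R^3$ with the real $3\times3$ matrices by $\omega\otimes\eta=\omega\eta^{\mathrm T}$. The normalized states of the maximal tensor product of two pentagon systems are the matrices $\Phi\in\mathbb R^{3\times 3}$ with $e^{\mathrm T}\Phi f\ge 0$ for all $e,f\in\mathcal E$ and $u^{\mathrm T}\Phi u=1$. Such a state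 is a product state if $\Phi=\omega\otimes\eta$ with $\omega,\eta\in\Omega$, and it is entangled if it is not a convex combination of product states. Call two matrices $\Phi,\Psi$ locally equivalent if $\Psi=S\,\Phi\,T^{\mathrm T}$ for some reversible transformations $S,T$; this is an equivalence relation. The convex set of normalized states of the maximal tensor product of two pentagon systems has exactly $135$ extreme points. Exactly $25$ of them are product states, namely the $\omega_i\otimes\omega_j$ with $1\le i,j\le5$, and the other $110$ are entangled. The $110$ extreme entangled states form exactly two classes under local equivalence: the Janotta class, which consists of $10$ states and contains $$\Phi_J=\begin{pmatrix}1&0&0\\0&1&0\\0&0&1\end{pmatrix},$$ and the Hardy class, which consists of $100$ states and contains $$\Phi_H=\begin{pmatrix}-\cos\frac{\pi}{5}&\frac{-r^6\sin(\pi/5)}{8(1+r^2)}&0\\ \frac{-r^6\sin(\pi/5)}{8(1+r^2)}&\cos\frac{\pi}{5}&\frac{-r^3}{4\sin(\pi/5)}\\0&\frac{-r^3}{4\sin(\pi/5)}&1\end{pmatrix}.$$ -/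

import Mathlib

noncomputable section

namespace Polygon

open Matrix

/-- The ambient space `V = ℝ³` of a single polygon system; its dual is identified with `ℝ³` by the
dot product, so that the effect `e` takes the value `e ⬝ᵥ ω` on the state `ω`. -/
abbrev Vec : Type := Fin 3 → ℝ

/-- The ambient space `V ⊗ V` of a bipartite system, written as `3 × 3` matrices:
`ω ⊗ η` is the matrix `ω ηᵀ`. -/
abbrev BiVec : Type := Matrix (Fin 3) (Fin 3) ℝ

/-- The scale `r_n = √(sec (π / n))`, for `n ≥ 3`. -/
def radius (n : ℕ) : ℝ := Real.sqrt (1 / Real.cos (Real.pi / n))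

/-- The pure state `ω_i` of the `n`-gon system, `1 ≤ i ≤ n`. -/
def pureState (n i : ℕ) : Vec :=
  ![radius n * Real.cos (2 * Real.pi * i / n), radius n * Real.sin (2 * Real.pi * i / n), 1]

/-- The normalized state space `Ω_n`: a regular `n`-gon in the plane `z = 1`. -/
def stateSpace (n : ℕ) : Set Vec := convexHull ℝ (pureState n '' Set.Icc 1 n)

/-- The unit effect `u`. -/
def unitEffect : Vec := ![0, 0, 1]

/-- The effect space: all functionals with values in `[0, 1]` on all states. -/
def effectSpace (n : ℕ) : Set Vec :=
  {e | ∀ ω ∈ stateSpace n, 0 ≤ e ⬝ᵥ ω ∧ e ⬝ᵥ ω ≤ 1}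

/-- The reversible transformation `T_k^s` of the `n`-gon (`s = 1`: rotation, `s = -1`:
reflection). -/
def transformation (n k : ℕ) (s : ℝ) : Matrix (Fin 3) (Fin 3) ℝ :=
  !![Real.cos (2 * Real.pi * k / n), -s * Real.sin (2 * Real.pi * k / n), 0;
     Real.sin (2 * Real.pi * k / n), s * Real.cos (2 * Real.pi * k / n), 0;
     0, 0, 1]

/-- The dihedral set of the `2n` reversible transformations of the `n`-gon. -/
def reversible (n : ℕ) : Set (Matrix (Fin 3) (Fin 3) ℝ) :=
  {T | ∃ k ∈ Set.Icc 1 n, ∃ s : ℝ, (s = 1 ∨ s = -1) ∧ T = transformation n k s}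

/-- The product vector `ω ⊗ η`. -/
def tensor (ω η : Vec) : BiVec := vecMulVec ω η

/-- The value `(e ⊗ f)(Φ)` of a product effect on `Φ`; on `ω ⊗ η` it is `(e ⬝ᵥ ω) (f ⬝ᵥ η)`. -/
def prodEffect (e f : Vec) (Φ : BiVec) : ℝ := e ⬝ᵥ (Φ *ᵥ f)

theorem prodEffect_tensor (e f ω η : Vec) :
    prodEffect e f (tensor ω η) = (e ⬝ᵥ ω) * (f ⬝ᵥ η) := by
  simp [prodEffect, tensor, vecMulVec, Matrix.mulVec, dotProduct, Fin.sum_univ_three]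
  ring

/-- The normalized states of the maximal tensor product of two `n`-gon systems. -/
def maxTensor (n : ℕ) : Set BiVec :=
  {Φ | (∀ e ∈ effectSpace n, ∀ f ∈ effectSpace n, 0 ≤ prodEffect e f Φ) ∧
    prodEffect unitEffect unitEffect Φ = 1}

/-- The normalized product states. -/
def productStates (n : ℕ) : Set BiVec :=
  {Φ | ∃ ω ∈ stateSpace n, ∃ η ∈ stateSpace n, Φ = tensor ω η}

/-- The normalized states of the minimal tensor product: the mixtures of product states. -/
def minTensor (n : ℕ) : Set BiVec := convexHull ℝ (productStates n)

/-- The extreme (pure) normalized states of the maximal tensor product. -/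
def extremeStates (n : ℕ) : Set BiVec := (maxTensor n).extremePoints ℝ

/-- The extreme states that are entangled, that is, not in the minimal tensor product. -/
def extremeEntangled (n : ℕ) : Set BiVec := extremeStates n \ minTensor n

/-- Equivalence under the transformations `S ⊗ T` with `S`, `T` reversible; in matrix form
`(S ⊗ T)(Φ) = S Φ Tᵀ`. -/
def LocallyEquivalent (n : ℕ) (Φ Ψ : BiVec) : Prop :=
  ∃ S ∈ reversible n, ∃ T ∈ reversible n, Ψ = S * Φ * Tᵀ

theorem localAction_tensor (S T : Matrix (Fin 3) (Fin 3) ℝ) (ω η : Vec) :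
    S * tensor ω η * Tᵀ = tensor (S *ᵥ ω) (T *ᵥ η) := by
  simp [tensor, Matrix.mul_vecMulVec, Matrix.vecMulVec_mul, Matrix.vecMul_transpose]

/-- The class of `Φ` under local reversible transformations. -/
def localClass (n : ℕ) (Φ : BiVec) : Set BiVec := {Ψ | LocallyEquivalent n Φ Ψ}

/-- The state `Φ_J` (for odd `n`). -/
def phiJ : BiVec := !![1, 0, 0; 0, 1, 0; 0, 0, 1]

/-- The state `Φ_H` of the bipartite pentagon system. -/
def phiH : BiVec :=
  !![-Real.cos (Real.pi / 5),
       -radius 5 ^ 6 * Real.sin (Real.pi / 5) / (8 * (1 + radius 5 ^ 2)), 0;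
     -radius 5 ^ 6 * Real.sin (Real.pi / 5) / (8 * (1 + radius 5 ^ 2)),
       Real.cos (Real.pi / 5), -radius 5 ^ 3 / (4 * Real.sin (Real.pi / 5));
     0, -radius 5 ^ 3 / (4 * Real.sin (Real.pi / 5)), 1]

end Polygon

end

noncomputable section

namespace Polygon

open Matrix

/-! With this choice of $r$ the pentagon is self-dual: the cone of nonnegative functionals is
spanned by the vertices themselves. So a bipartite state is determined by its $5\times5$ table of
values on pairs of vertices, and the normalized states of the maximal tensor product are exactly the
nonnegative tables with total 25 (`mem_maxTensor_iff`, resting on `exists_eq_sum_vertex`). Local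
reversible transformations permute rows and columns of the table by dihedral permutations
(`locallyEquivalent_iff`).

The maximal tensor product is a polytope, so its vertices can be studied through the zero sets of
their tables. If a state vanishes wherever an extreme state does, the two are equal
(`eq_of_zeros_le`), and each state has its zeros contained in those of some extreme state
(`exists_extremeState`).

It remains to find the maximal zero patterns. The linear relations between table entries, read with
nonnegativity, force closure rules on the zeros (`IsTable.saturated`). A finite search over all
patterns obeying these rules shows that each lies inside a pattern from the orbits of three
representatives: a product of two vertices, $\Phi_J$ and $\Phi_H$ (`Saturated.exists_le`). Hence
every extreme state belongs to one of the three local classes. Conversely the $25+10+100$ patterns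
form an antichain (`sub_codeList`), so every member of these classes is extreme
(`extremeStates_eq`).

Since distinct extreme states have distinct patterns, counting states is counting patterns
(`ncard_localClass`). An extreme state that is a mixture of product states is itself a product
state, so the last two classes are precisely the entangled ones. -/

/-! ### Zero patterns and the dihedral action on them -/

/-- The index set of the reversible transformations: a rotation number and an orientation. -/
abbrev Dih : Type := Fin 5 × Bool

/-- The permutation of the vertices by which the transpose of a reversible transformation acts. -/
def act (g : Dih) (i : Fin 5) : Fin 5 := bif g.2 then i - g.1 else g.1 - i

/-- The composition law for `act`. -/
def dihComp (g h : Dih) : Dih :=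
  bif g.2 then (bif h.2 then (h.1 + g.1, true) else (h.1 - g.1, false))
  else (bif h.2 then (g.1 + h.1, false) else (h.1 - g.1, true))

/-- The inverse for `act`. -/
def dihInv (g : Dih) : Dih := bif g.2 then (0 - g.1, true) else g

theorem act_dihComp : ∀ (g h : Dih) (i : Fin 5), act (dihComp g h) i = act g (act h i) := by
  decide +kernel

theorem act_dihInv : ∀ (g : Dih) (i : Fin 5), act g (act (dihInv g) i) = i := by decide +kernel

theorem dihInv_act : ∀ (g : Dih) (i : Fin 5), act (dihInv g) (act g i) = i := by decide +kernel

/-- Rotations keep the order of a pair at cyclic distance two and reflections swap it. This is what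
carries the row and column rules of `Saturated` through `pull`. -/
theorem act_add_two : ∀ (g : Dih) (i : Fin 5),
    act g (i + 2) = act g i + 2 ∨ act g i = act g (i + 2) + 2 := by decide +kernel

/-- A set of cells of a `5 × 5` table. -/
abbrev Pattern : Type := Fin 5 → Fin 5 → Bool

/-- The pattern `z` with its rows and columns permuted. -/
def Pattern.pull (z : Pattern) (g h : Dih) : Pattern := fun i j => z (act g i) (act h j)

theorem Pattern.pull_pull (z : Pattern) (g h g' h' : Dih) :
    (z.pull g h).pull g' h' = z.pull (dihComp g g') (dihComp h h') := by
  funext i j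
  simp only [Pattern.pull, act_dihComp]

theorem Pattern.le_pull_iff {y z : Pattern} {g h : Dih} :
    y ≤ z.pull g h ↔ y.pull (dihInv g) (dihInv h) ≤ z := by
  constructor
  · intro H i j
    have := H (act (dihInv g) i) (act (dihInv h) j)
    simpa only [Pattern.pull, act_dihInv] using this
  · intro H i j
    have := H (act g i) (act h j)
    simpa only [Pattern.pull, dihInv_act] using this

/-- A pattern as a binary number, one bit for each cell. -/
def code (z : Pattern) : ℕ := Nat.ofBits fun k : Fin (5 * 5) => z k.divNat k.modNat

/-- Inclusion of binary numbers read as sets of bits. -/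
def sub (a b : ℕ) : Bool := Nat.beq (Nat.land a b) a

theorem sub_iff {a b : ℕ} : sub a b = true ↔ ∀ k, a.testBit k = true → b.testBit k = true := by
  have : sub a b = true ↔ a &&& b = a := by
    unfold sub
    exact iff_of_eq Nat.beq_eq
  rw [this]
  constructor
  · intro h k hk
    rw [← h, Nat.testBit_and, Bool.and_eq_true] at hk
    exact hk.2
  · intro h
    refine Nat.eq_of_testBit_eq fun k => ?_
    have := h k
    rw [Nat.testBit_and]
    cases ha : a.testBit k <;> simp_all

theorem testBit_code (z : Pattern) (i j : Fin 5) :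
    (code z).testBit (finProdFinEquiv (i, j)) = z i j := by
  rw [code, Nat.testBit_ofBits_lt _ _ (finProdFinEquiv (i, j)).isLt]
  have := finProdFinEquiv.symm_apply_apply (i, j)
  simp only [finProdFinEquiv_symm_apply, Prod.mk.injEq] at this
  change z (finProdFinEquiv (i, j)).divNat (finProdFinEquiv (i, j)).modNat = _
  rw [this.1, this.2]

/-- Turns inclusion of patterns into one bitwise operation on 25-bit numbers, cheap enough for the
kernel to repeat throughout the search. -/
theorem sub_code_iff {y z : Pattern} : sub (code y) (code z) = true ↔ y ≤ z := by
  rw [sub_iff]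
  constructor
  · intro h i j
    have := h (finProdFinEquiv (i, j))
    rw [testBit_code, testBit_code] at this
    exact Bool.le_iff_imp.2 this
  · intro h k hk
    by_cases hlt : k < 5 * 5
    · obtain ⟨⟨i, j⟩, hij⟩ := finProdFinEquiv.surjective (⟨k, hlt⟩ : Fin (5 * 5))
      have hk' : k = (finProdFinEquiv (i, j)).val := by rw [hij]
      rw [hk', testBit_code] at hk ⊢
      exact Bool.le_iff_imp.1 (h i j) hk
    · rw [code, Nat.testBit_ofBits_ge _ _ (not_lt.1 hlt)] at hk
      exact absurd hk (by simp)

theorem code_injective : Function.Injective code := fun _ _ h =>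
  le_antisymm (sub_code_iff.1 (sub_iff.2 fun _ hk => h ▸ hk))
    (sub_code_iff.1 (sub_iff.2 fun _ hk => h ▸ hk))

/-- The pattern whose rows are given as binary numbers. -/
def ofRows (r : List ℕ) : Pattern := fun i j => (r.getD i 0).testBit j

/-- The zeros of the table of `Φ_J`. -/
def patJ : Pattern := ofRows [12, 24, 17, 3, 6]

/-- The zeros of the table of `Φ_H`. -/
def patH : Pattern := ofRows [3, 17, 12, 4, 2]

/-- The zeros of the table of `ω_0 ⊗ ω_0`. -/
def patP : Pattern := ofRows [12, 12, 31, 31, 12]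

/-- Four cells whose vanishing forces the cells of `forced₁` to vanish. -/
def source₁ : Pattern := ofRows [1, 2, 8, 0, 4]

/-- See `source₁`. -/
def forced₁ : Pattern := ofRows [2, 1, 4, 0, 8]

/-- Four cells whose vanishing forces the cells of `forced₂` to vanish. -/
def source₂ : Pattern := ofRows [1, 2, 16, 0, 4]

/-- See `source₂`. -/
def forced₂ : Pattern := ofRows [2, 1, 4, 0, 16]

/-- Five cells that cannot vanish together. -/
def transversal : Pattern := ofRows [1, 4, 16, 2, 8]

/-- The closure properties of the zero pattern of a nonzero nonnegative table. -/
structure Saturated (z : Pattern) : Prop where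
  row : ∀ i j, z i j = true → z i (j + 2) = true → ∀ k, z i k = true
  col : ∀ i j, z i j = true → z (i + 2) j = true → ∀ k, z k j = true
  rule₁ : ∀ g h, source₁.pull g h ≤ z → forced₁.pull g h ≤ z
  rule₂ : ∀ g h, source₂.pull g h ≤ z → forced₂.pull g h ≤ z
  not_transversal_le : ∀ g h, ¬ transversal.pull g h ≤ z

/-- Justifies moving a distinguished row and column pair to standard position before searching. -/
theorem Saturated.pull {z : Pattern} (hz : Saturated z) (a b : Dih) : Saturated (z.pull a b) where
  row i j h h' k := by
    rcases act_add_two b j with e | e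
    · exact hz.row _ (act b j) h (by rw [← e]; exact h') _
    · exact hz.row _ (act b (j + 2)) h' (by rw [← e]; exact h) _
  col i j h h' k := by
    rcases act_add_two a i with e | e
    · exact hz.col (act a i) _ h (by rw [← e]; exact h') _
    · exact hz.col (act a (i + 2)) _ h' (by rw [← e]; exact h) _
  rule₁ g h H := by
    rw [Pattern.le_pull_iff, Pattern.pull_pull] at H ⊢
    exact hz.rule₁ _ _ H
  rule₂ g h H := by
    rw [Pattern.le_pull_iff, Pattern.pull_pull] at H ⊢
    exact hz.rule₂ _ _ H
  not_transversal_le g h H := by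
    rw [Pattern.le_pull_iff, Pattern.pull_pull] at H
    exact hz.not_transversal_le _ _ H

/-! ### The orbits of the patterns, as lists of codes -/

/-- All elements of `Dih`. -/
def allDih : List Dih := (List.finRange 5).product [true, false]

/-- The rotations in `Dih`. -/
def rotations : List Dih := (List.finRange 5).map fun k => (k, true)

/-- The codes of the orbit of `patH`. -/
def codeListH : List ℕ :=
  [2241059, 17051761, 4481126, 1597635, 8930508, 2147718, 16813464, 4263692, 1121041, 8526392,
   18223171, 3547665, 3940486, 7094307, 6865164, 13141062, 12682776, 25266316, 25364529,
   18026776, 4605026, 8785456, 9178308, 17569889, 17340808, 1618114, 1159952, 2220420, 2318881,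
   4409096, 12716145, 12861987, 25432259, 25691238, 18358662, 17860812, 3195660, 3215768,
   6358584, 6431505, 13143108, 12699144, 25270408, 25365552, 18034960, 18225217, 3564033,
   3944578, 7095330, 6873348, 4263468, 8930412, 8525944, 16813272, 17051857, 1120657, 1597827,
   2241283, 2148102, 4481574, 17926284, 3719436, 3346712, 6391320, 6693393, 12781617, 13385763,
   25563203, 25723974, 18620550, 2213252, 17337736, 4394760, 1153808, 8788528, 2306593,
   17576033, 4612194, 1630402, 9192644, 3215761, 18358659, 6431491, 3195654, 12861990, 6358572,
   25691244, 12716152, 17860824, 25432273, 3715202, 17936656, 6414596, 3367425, 12797448,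
   6702114, 25562160, 13372484, 18618433, 25729160]

/-- The codes of the orbit of `patJ`. -/
def codeListJ : List ℕ :=
  [6407948, 25726156, 3727750, 17930648, 18624707, 3355409, 25565297, 6709795, 12783160,
   13386854]

/-- The codes of the orbit of `patP`. -/
def codeListP : List ℕ :=
  [13630860, 26214168, 18873905, 4193379, 7339206, 33534348, 33547032, 33539633, 33524835,
   33528006, 32911775, 33317663, 33080895, 32607359, 32708831, 12989439, 25977855, 18401279,
   3248127, 6495231, 13008876, 25985016, 18415601, 3276771, 6520806]

/-- The codes of the orbit of `source₁`, with those of `forced₁`. -/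
def ruleList₁ : List (ℕ × ℕ) :=
  [(4202561, 8392738), (8393217, 4202544), (8405122, 16785476), (16785442, 8405057), (16778500,
   1065096), (1065028, 16778370), (1051144, 2098448), (2098312, 1050884), (2101296, 4196865),
   (4196624, 2101768), (2359425, 1179906), (16908545, 1310864), (4718850, 2359812), (1311234,
   2621697), (8421892, 4718632), (2621476, 4227586), (16842792, 8421456), (4227144, 8454180),
   (1179728, 16842881), (8454288, 16908360), (264228, 132168), (147496, 263684), (528456,
   264336), (263248, 526376), (41104, 528641), (526465, 36944), (82177, 41474), (37122, 73857),
   (132610, 81956), (74244, 147714), (8392738, 4202561), (4202544, 8393217), (16785476,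
   8405122), (8405057, 16785442), (1065096, 16778500), (16778370, 1065028), (2098448, 1051144),
   (1050884, 2098312), (4196865, 2101296), (2101768, 4196624), (8455296, 4229376), (4719872,
   8437888), (16910592, 8458752), (8423936, 16844032), (1315328, 16916512), (16846880, 1182208),
   (2629664, 1327168), (1187904, 2363424), (4243520, 2622592), (2375808, 4726848), (132168,
   264228), (263684, 147496), (264336, 528456), (526376, 263248), (528641, 41104), (36944,
   526465), (41474, 82177), (73857, 37122), (81956, 132610), (147714, 74244), (2134024,
   1122308), (16818180, 1576968), (4268048, 2244616), (1130504, 2138128), (8536065, 4457488),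
   (2229264, 4276225), (17040386, 8914945), (4458497, 8520706), (1574916, 16814082), (8916994,
   17041412), (4229376, 8455296), (8437888, 4719872), (8458752, 16910592), (16844032, 8423936),
   (16916512, 1315328), (1182208, 16846880), (1327168, 2629664), (2363424, 1187904), (2622592,
   4243520), (4726848, 2375808), (1179906, 2359425), (1310864, 16908545), (2359812, 4718850),
   (2621697, 1311234), (4718632, 8421892), (4227586, 2621476), (8421456, 16842792), (8454180,
   4227144), (16842881, 1179728), (16908360, 8454288), (1122308, 2134024), (1576968, 16818180),
   (2244616, 4268048), (2138128, 1130504), (4457488, 8536065), (4276225, 2229264), (8914945,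
   17040386), (8520706, 4458497), (16814082, 1574916), (17041412, 8916994)]

/-- The codes of the orbit of `source₂`, with those of `forced₂`. -/
def ruleList₂ : List (ℕ × ℕ) :=
  [(4210753, 16781346), (8389762, 1056836), (16779524, 2113672), (1053192, 4195600), (2105392,
   8391169), (2621569, 1180162), (4227330, 2359332), (8454660, 4718664), (16908328, 8421520),
   (1310800, 16843009), (526372, 132176), (36936, 264321), (73872, 528642), (147713, 41476),
   (263682, 81960), (16781346, 4210753), (1056836, 8389762), (2113672, 16779524), (4195600,
   1053192), (8391169, 2105392), (16843904, 4229632), (1181952, 8458272), (2363904, 16916544),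
   (4726816, 1327232), (8437824, 2622720), (132176, 526372), (264321, 36936), (528642, 73872),
   (41476, 147713), (81960, 263682), (2134032, 1130500), (4268033, 2229256), (8536066, 4458512),
   (17040388, 8916993), (1574920, 16818178), (4229632, 16843904), (8458272, 1181952), (16916544,
   2363904), (1327232, 4726816), (2622720, 8437824), (1180162, 2621569), (2359332, 4227330),
   (4718664, 8454660), (8421520, 16908328), (16843009, 1310800), (1130500, 2134032), (2229256,
   4268033), (4458512, 8536066), (8916993, 17040388), (16818178, 1574920)]

/-- The codes of the orbit of `transversal`. -/
def codeListT : List ℕ :=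
  [8470657, 4720897, 2625576, 16850980, 16909570, 2360464, 4235344, 8425986, 1313284, 1196104]

/-- These identities certify the literal lists, which are kept explicit so that the search need not
recompute them. Where only part of `allDih × allDih` is used, the pattern or rule has a symmetry
that makes the remaining pairs redundant. -/
theorem codeListH_eq : codeListH =
    (allDih.product allDih).map fun p => code (patH.pull p.1 p.2) := by decide +kernel

theorem codeListJ_eq : codeListJ = allDih.map fun g => code (patJ.pull g (0, true)) := by
  decide +kernel

theorem codeListP_eq : codeListP =
    (rotations.product rotations).map fun p => code (patP.pull p.1 p.2) := by decide +kernel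

theorem ruleList₁_eq : ruleList₁ = (allDih.product allDih).map fun p =>
    (code (source₁.pull p.1 p.2), code (forced₁.pull p.1 p.2)) := by decide +kernel

theorem ruleList₂_eq : ruleList₂ = (allDih.product rotations).map fun p =>
    (code (source₂.pull p.1 p.2), code (forced₂.pull p.1 p.2)) := by decide +kernel

theorem codeListT_eq : codeListT = allDih.map fun g => code (transversal.pull g (0, true)) := by
  decide +kernel

/-! ### An exhaustive search over the saturated patterns -/

/-- Existential quantification over a list, written with the recursor for fast reduction. -/
noncomputable def anyOf {α : Type} (l : List α) (f : α → Bool) : Bool :=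
  List.rec (motive := fun _ => Bool) false (fun x _ ih => Bool.rec ih true (f x)) l

/-- Universal quantification over a list, written with the recursor for fast reduction. -/
noncomputable def allOf {α : Type} (l : List α) (f : α → Bool) : Bool :=
  List.rec (motive := fun _ => Bool) true (fun x _ ih => Bool.rec false ih (f x)) l

/-- Lazy implication. -/
noncomputable def implies (a b : Bool) : Bool := Bool.rec true b a

theorem anyOf_iff {α : Type} {l : List α} {f : α → Bool} :
    anyOf l f = true ↔ ∃ x ∈ l, f x = true := by
  induction l with
  | nil => simp [anyOf]
  | cons x l ih =>
    have : anyOf (x :: l) f = Bool.rec (anyOf l f) true (f x) := rfl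
    rw [this]
    cases h : f x <;> simp [h, ih]

theorem allOf_iff {α : Type} {l : List α} {f : α → Bool} :
    allOf l f = true ↔ ∀ x ∈ l, f x = true := by
  induction l with
  | nil => simp [allOf]
  | cons x l ih =>
    have : allOf (x :: l) f = Bool.rec false (allOf l f) (f x) := rfl
    rw [this]
    cases h : f x <;> simp [h, ih]

theorem implies_iff {a b : Bool} : implies a b = true ↔ (a = true → b = true) := by
  cases a <;> simp [implies]

/-- The set `m` of cells breaks none of the given rules. -/
noncomputable def obeys (l : List (ℕ × ℕ)) (m : ℕ) : Bool :=
  allOf l fun r => implies (sub r.1 m) (sub r.2 m)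

/-- The set `m` of cells lies in one of the known patterns or breaks a rule. -/
noncomputable def settled (m : ℕ) : Bool :=
  -- `implies (implies b false) c` is a lazy "b or c": later tests run only when `m` is in none of
  -- the known patterns tried so far.
  implies (implies (anyOf codeListH (sub m)) false) <|
  implies (implies (anyOf codeListJ (sub m)) false) <|
  implies (implies (anyOf codeListP (sub m)) false) <|
  implies (obeys ruleList₂ m) <| implies (obeys ruleList₁ m) <| anyOf codeListT fun r => sub r m

/-- All choices for the last row give settled sets of cells. -/
noncomputable def searchRow₄ (rows : List ℕ) (a b c d : ℕ) : Bool := allOf rows fun e =>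
  -- The column rule prunes here: two rows at cyclic distance two, namely (a,c), (a,d), (b,d),
  -- (b,e), (c,e), can share a zero only in a column that vanishes entirely. Conditions on earlier
  -- rows alone were tested before this point.
  implies (sub (Nat.land a c) e) <| implies (sub (Nat.land a d) e) <|
  implies (sub (Nat.land b d) e) <| implies (sub (Nat.land b e) (Nat.land a (Nat.land c d))) <|
  implies (sub (Nat.land c e) (Nat.land a (Nat.land b d))) <|
  settled (a + 32 * b + 1024 * c + 32768 * d + 1048576 * e)

/-- All choices for the last two rows give settled sets of cells. -/
noncomputable def searchRow₃ (rows : List ℕ) (a b c : ℕ) : Bool := allOf rows fun d =>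
  implies (sub (Nat.land a c) d) <| implies (sub (Nat.land a d) (Nat.land b c)) <|
  implies (sub (Nat.land b d) (Nat.land a c)) <| searchRow₄ rows a b c d

/-- All choices of the five rows, the first one from a list of its own, give settled sets. -/
noncomputable def searchAll (first rows : List ℕ) : Bool :=
  allOf first fun a => allOf rows fun b => allOf rows fun c =>
  implies (sub (Nat.land a c) b) <| searchRow₃ rows a b c

/-- The rows with at most one zero. -/
def sparseRows : List ℕ := [0, 1, 2, 4, 8, 16]

/-- The rows that a saturated pattern can have. -/
def allRows : List ℕ := [0, 1, 2, 4, 8, 16, 3, 6, 12, 24, 17, 31]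

/-- The search splits in two. Either no row has two adjacent zeros and all rows are sparse, or by
symmetry row 0 vanishes in columns 0 and 1, leaving two choices for that row. -/
theorem searchAll_sparse : searchAll sparseRows sparseRows = true := by decide +kernel

theorem searchAll_pair : searchAll [3, 31] allRows = true := by decide +kernel

/-- Among three points of a 5-cycle two are at distance two, so a row closed under the row rule is
empty, a single zero, an adjacent pair, or full. -/
theorem row_mem_allRows : ∀ f : Fin 5 → Bool,
    (∀ j, f j = true → f (j + 2) = true → ∀ k, f k = true) → Nat.ofBits f ∈ allRows := by
  decide +kernel

theorem row_mem_sparseRows : ∀ f : Fin 5 → Bool,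
    (∀ j, f j = true → f (j + 2) = true → ∀ k, f k = true) →
    (∀ j, ¬ (f j = true ∧ f (j + 1) = true)) → Nat.ofBits f ∈ sparseRows := by
  decide +kernel

theorem row_mem_pair : ∀ f : Fin 5 → Bool,
    (∀ j, f j = true → f (j + 2) = true → ∀ k, f k = true) →
    f 0 = true → f 1 = true → Nat.ofBits f ∈ [3, 31] := by
  decide +kernel

theorem exists_act_eq : ∀ j : Fin 5, ∃ h : Dih, act h 0 = j ∧ act h 1 = j + 1 := by decide +kernel

theorem ofBits_add {m n : ℕ} (f : Fin (m + n) → Bool) : Nat.ofBits f =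
    Nat.ofBits (fun i => f (Fin.castAdd n i)) +
      2 ^ m * Nat.ofBits (fun i => f (Fin.natAdd m i)) := by
  refine Nat.eq_of_testBit_eq fun k => ?_
  rw [add_comm (Nat.ofBits _), Nat.testBit_two_pow_mul_add _ (Nat.ofBits_lt_two_pow _),
    Nat.testBit_ofBits, Nat.testBit_ofBits, Nat.testBit_ofBits]
  by_cases h : k < m
  · simp [h, h.trans_le (Nat.le_add_right m n)]
  · by_cases h' : k < m + n
    · have : k - m < n := by omega
      simp only [h, h', this, dif_pos, if_false]
      exact congrArg f (Fin.ext (by simp; omega))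
    · have : ¬ k - m < n := by omega
      simp [h, h', this]

theorem code_eq_rows (z : Pattern) : code z = Nat.ofBits (z 0) + 32 * Nat.ofBits (z 1) +
    1024 * Nat.ofBits (z 2) + 32768 * Nat.ofBits (z 3) + 1048576 * Nat.ofBits (z 4) := by
  -- The 25 bits are cut as 5 + (5 + (5 + (5 + 5))), one block for each row.
  have h : ∀ f : Fin (5 * 5) → Bool, Nat.ofBits f = _ := fun f =>
    (ofBits_add (m := 5) (n := 5 + (5 + (5 + 5))) f).trans <| congrArg _ <| congrArg _ <|
    (ofBits_add (m := 5) _).trans <| congrArg _ <| congrArg _ <|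
    (ofBits_add (m := 5) _).trans <| congrArg _ <| congrArg _ <| ofBits_add (m := 5) _
  have e (i : Fin 5) (f : Fin 5 → Bool) (hf : ∀ j, f j = z i j) : Nat.ofBits f = Nat.ofBits (z i) :=
    congrArg _ (funext hf)
  rw [code, h]
  refine Eq.trans (congrArg₂ _ (e 0 _ ?_) (congrArg _ (congrArg₂ _ (e 1 _ ?_) (congrArg _
    (congrArg₂ _ (e 2 _ ?_) (congrArg _ (congrArg₂ _ (e 3 _ ?_) (congrArg _ (e 4 _ ?_)))))))))
    (by ring)
  all_goals
    intro j
    fin_cases j <;> rfl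

theorem testBit_row (f : Fin 5 → Bool) (k : ℕ) :
    (Nat.ofBits f).testBit k = true ↔ ∃ h : k < 5, f ⟨k, h⟩ = true := by
  by_cases h : k < 5
  · rw [Nat.testBit_ofBits_lt _ _ h]
    simp [h]
  · rw [Nat.testBit_ofBits_ge _ _ (not_lt.1 h)]
    simp [h]

theorem sub_rows {a b c : Fin 5 → Bool} (h : ∀ k, a k = true → b k = true → c k = true) :
    sub (Nat.land (Nat.ofBits a) (Nat.ofBits b)) (Nat.ofBits c) = true := by
  refine sub_iff.2 fun k hk => ?_
  change (Nat.ofBits a &&& Nat.ofBits b).testBit k = true at hk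
  rw [Nat.testBit_and, Bool.and_eq_true, testBit_row, testBit_row] at hk
  obtain ⟨⟨hk5, ha⟩, _, hb⟩ := hk
  exact (testBit_row c k).2 ⟨hk5, h _ ha hb⟩

theorem sub_land {a b c : ℕ} (h : sub a b = true) (h' : sub a c = true) :
    sub a (Nat.land b c) = true := by
  refine sub_iff.2 fun k hk => ?_
  change (b &&& c).testBit k = true
  rw [Nat.testBit_and, Bool.and_eq_true]
  exact ⟨sub_iff.1 h k hk, sub_iff.1 h' k hk⟩

theorem Saturated.settled {z : Pattern} (hz : Saturated z) {first rows : List ℕ}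
    (hs : searchAll first rows = true) (h0 : Nat.ofBits (z 0) ∈ first)
    (h : ∀ i, i ≠ 0 → Nat.ofBits (z i) ∈ rows) : settled (code z) = true := by
  have c02 : ∀ i k, z 0 k = true → z 2 k = true → z i k = true := fun i k h h' =>
    hz.col 0 k h h' i
  -- Since 3 + 2 = 0 in `Fin 5`, the pair starts at row 3; likewise 4 + 2 = 1 below.
  have c03 : ∀ i k, z 0 k = true → z 3 k = true → z i k = true := fun i k h h' =>
    hz.col 3 k h' h i
  have c13 : ∀ i k, z 1 k = true → z 3 k = true → z i k = true := fun i k h h' =>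
    hz.col 1 k h h' i
  have c14 : ∀ i k, z 1 k = true → z 4 k = true → z i k = true := fun i k h h' =>
    hz.col 4 k h' h i
  have c24 : ∀ i k, z 2 k = true → z 4 k = true → z i k = true := fun i k h h' =>
    hz.col 2 k h h' i
  have s := allOf_iff.1 (allOf_iff.1 (allOf_iff.1 hs _ h0) _ (h 1 (by decide))) _ (h 2 (by decide))
  have s := implies_iff.1 s (sub_rows (c02 1))
  have s := allOf_iff.1 s _ (h 3 (by decide))
  have s := implies_iff.1 s (sub_rows (c02 3))
  have s := implies_iff.1 s (sub_land (sub_rows (c03 1)) (sub_rows (c03 2)))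
  have s := implies_iff.1 s (sub_land (sub_rows (c13 0)) (sub_rows (c13 2)))
  have s := allOf_iff.1 s _ (h 4 (by decide))
  have s := implies_iff.1 s (sub_rows (c02 4))
  have s := implies_iff.1 s (sub_rows (c03 4))
  have s := implies_iff.1 s (sub_rows (c13 4))
  have s := implies_iff.1 s
    (sub_land (sub_rows (c14 0)) (sub_land (sub_rows (c14 2)) (sub_rows (c14 3))))
  have s := implies_iff.1 s
    (sub_land (sub_rows (c24 0)) (sub_land (sub_rows (c24 1)) (sub_rows (c24 3))))
  rw [code_eq_rows]
  exact s

/-- The orbit of a pattern under permutations of the rows and the columns. -/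
def Pattern.orbit (y : Pattern) : Set Pattern := {z | ∃ g h, z = y.pull g h}

theorem Pattern.pull_mem_orbit {y z : Pattern} (hz : z ∈ y.orbit) (g h : Dih) :
    z.pull g h ∈ y.orbit := by
  obtain ⟨a, b, rfl⟩ := hz
  exact ⟨_, _, Pattern.pull_pull _ _ _ _ _⟩

/-- The patterns of the extreme states. -/
def extremePatterns : Set Pattern := patP.orbit ∪ (patJ.orbit ∪ patH.orbit)

theorem pull_mem_extremePatterns {z : Pattern} (hz : z ∈ extremePatterns) (g h : Dih) :
    z.pull g h ∈ extremePatterns := by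
  rcases hz with hz | hz | hz
  · exact Or.inl (Pattern.pull_mem_orbit hz _ _)
  · exact Or.inr (Or.inl (Pattern.pull_mem_orbit hz _ _))
  · exact Or.inr (Or.inr (Pattern.pull_mem_orbit hz _ _))

/-- Saturation rules out every way of being settled other than containment in a known pattern: no
rule is broken and no transversal is contained. -/
theorem Saturated.exists_le_of_settled {z : Pattern} (hz : Saturated z)
    (h : Polygon.settled (code z) = true) : ∃ y ∈ extremePatterns, z ≤ y := by
  have neg {b : Bool} (hb : ¬ b = true) : implies b false = true :=
    implies_iff.2 fun h => absurd h hb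
  by_cases hH : anyOf codeListH (sub (code z)) = true
  · obtain ⟨m, hm, hs⟩ := anyOf_iff.1 hH
    rw [codeListH_eq, List.mem_map] at hm
    obtain ⟨p, -, rfl⟩ := hm
    exact ⟨_, Or.inr (Or.inr ⟨_, _, rfl⟩), sub_code_iff.1 hs⟩
  by_cases hJ : anyOf codeListJ (sub (code z)) = true
  · obtain ⟨m, hm, hs⟩ := anyOf_iff.1 hJ
    rw [codeListJ_eq, List.mem_map] at hm
    obtain ⟨p, -, rfl⟩ := hm
    exact ⟨_, Or.inr (Or.inl ⟨_, _, rfl⟩), sub_code_iff.1 hs⟩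
  by_cases hP : anyOf codeListP (sub (code z)) = true
  · obtain ⟨m, hm, hs⟩ := anyOf_iff.1 hP
    rw [codeListP_eq, List.mem_map] at hm
    obtain ⟨p, -, rfl⟩ := hm
    exact ⟨_, Or.inl ⟨_, _, rfl⟩, sub_code_iff.1 hs⟩
  exfalso
  have h := implies_iff.1 (implies_iff.1 (implies_iff.1 h (neg hH)) (neg hJ)) (neg hP)
  have h := implies_iff.1 h (allOf_iff.2 fun r hr => implies_iff.2 fun hs => by
    rw [ruleList₂_eq, List.mem_map] at hr
    obtain ⟨p, -, rfl⟩ := hr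
    exact sub_code_iff.2 (hz.rule₂ _ _ (sub_code_iff.1 hs)))
  have h := implies_iff.1 h (allOf_iff.2 fun r hr => implies_iff.2 fun hs => by
    rw [ruleList₁_eq, List.mem_map] at hr
    obtain ⟨p, -, rfl⟩ := hr
    exact sub_code_iff.2 (hz.rule₁ _ _ (sub_code_iff.1 hs)))
  obtain ⟨m, hm, hs⟩ := anyOf_iff.1 h
  rw [codeListT_eq, List.mem_map] at hm
  obtain ⟨p, -, rfl⟩ := hm
  exact hz.not_transversal_le _ _ (sub_code_iff.1 hs)

/-- A saturated pattern is contained in the pattern of an extreme state. -/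
theorem Saturated.exists_le {z : Pattern} (hz : Saturated z) : ∃ y ∈ extremePatterns, z ≤ y := by
  -- If some row has two adjacent zeros, rotate them to cells (0,0) and (0,1), search there, and
  -- rotate the containing pattern back.
  by_cases H : ∃ i j, z i j = true ∧ z i (j + 1) = true
  · obtain ⟨i, j, h, h'⟩ := H
    obtain ⟨a, ha, -⟩ := exists_act_eq i
    obtain ⟨b, hb, hb'⟩ := exists_act_eq j
    have hw := hz.pull a b
    have h0 : z.pull a b 0 0 = true := by simpa only [Pattern.pull, ha, hb] using h
    have h1 : z.pull a b 0 1 = true := by simpa only [Pattern.pull, ha, hb'] using h'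
    obtain ⟨y, hy, hle⟩ := hw.exists_le_of_settled <| hw.settled searchAll_pair
      (row_mem_pair _ (hw.row 0) h0 h1) fun i _ => row_mem_allRows _ (hw.row i)
    refine ⟨_, pull_mem_extremePatterns hy (dihInv a) (dihInv b), fun i j => ?_⟩
    have := hle (act (dihInv a) i) (act (dihInv b) j)
    simpa only [Pattern.pull, act_dihInv] using this
  · push Not at H
    have hr : ∀ i, Nat.ofBits (z i) ∈ sparseRows := fun i =>
      row_mem_sparseRows _ (hz.row i) fun j hj => H i j hj.1 hj.2
    exact hz.exists_le_of_settled (hz.settled searchAll_sparse (hr 0) fun i _ => hr i)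

theorem Pattern.pull_le_iff {y z : Pattern} {g h : Dih} :
    y.pull g h ≤ z ↔ y ≤ z.pull (dihInv g) (dihInv h) := by
  constructor
  · intro H i j
    have := H (act (dihInv g) i) (act (dihInv h) j)
    simpa only [Pattern.pull, act_dihInv] using this
  · intro H i j
    have := H (act g i) (act h j)
    simpa only [Pattern.pull, dihInv_act] using this

/-! ### Tables of values on the vertices -/

/-- The golden ratio. -/
def golden : ℝ := Real.goldenRatio

local notation "φ" => golden

local notation "σ" => Real.sin (Real.pi / 5)

theorem golden_sq : φ ^ 2 = φ + 1 := Real.goldenRatio_sq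

theorem one_lt_golden : 1 < φ := Real.one_lt_goldenRatio

theorem golden_pos : 0 < φ := Real.goldenRatio_pos

/-- The linear relations between the values of a functional on the vertices of a pentagon. -/
def IsPentagonal (a : Fin 5 → ℝ) : Prop := ∀ j, a (j + 3) - a j = φ * (a (j + 2) - a (j + 1))

/-- Four consecutive vertices go to four consecutive vertices, in the same or the opposite order;
reversal only changes the sign of both sides of the pentagonal relation. -/
theorem act_add : ∀ (g : Dih) (j : Fin 5), ∃ m,
    (act g j = m ∧ act g (j + 1) = m + 1 ∧ act g (j + 2) = m + 2 ∧ act g (j + 3) = m + 3) ∨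
    (act g j = m + 3 ∧ act g (j + 1) = m + 2 ∧ act g (j + 2) = m + 1 ∧ act g (j + 3) = m) := by
  decide +kernel

theorem IsPentagonal.comp_act {a : Fin 5 → ℝ} (ha : IsPentagonal a) (g : Dih) :
    IsPentagonal fun j => a (act g j) := by
  intro j
  obtain ⟨m, ⟨h0, h1, h2, h3⟩ | ⟨h0, h1, h2, h3⟩⟩ := act_add g j
  · simpa only [h0, h1, h2, h3] using ha m
  · simp only [h0, h1, h2, h3]
    linear_combination - ha m

/-- The relation at `j` reduces to `a (j + 3) = -φ * a (j + 1)`, so both vanish by nonnegativity.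
Geometrically, a line through two non-adjacent vertices separates the others. -/
theorem IsPentagonal.eq_zero {a : Fin 5 → ℝ} (ha : IsPentagonal a) (h0 : ∀ j, 0 ≤ a j) {j : Fin 5}
    (h : a j = 0) (h' : a (j + 2) = 0) (k : Fin 5) : a k = 0 := by
  have hφ := golden_pos
  have e0 := ha j
  have h1 : a (j + 1) = 0 := by nlinarith [h0 (j + 1), h0 (j + 3), mul_nonneg hφ.le (h0 (j + 1))]
  have h3 : a (j + 3) = 0 := by rw [h, h', h1] at e0; linarith
  have e1 := ha (j + 1)
  have h4 : a (j + 4) = 0 := by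
    simp only [add_assoc, Fin.reduceAdd, h', h3, h1] at e1
    linarith
  have hk : ∀ j k : Fin 5, k = j ∨ k = j + 1 ∨ k = j + 2 ∨ k = j + 3 ∨ k = j + 4 := by decide
  rcases hk j k with e | e | e | e | e <;> rw [e] <;> assumption

/-- A table whose rows and columns are pentagonal. -/
structure IsTable (M : Fin 5 → Fin 5 → ℝ) : Prop where
  row : ∀ i, IsPentagonal (M i)
  col : ∀ j, IsPentagonal fun i => M i j

theorem IsTable.comp_act {M : Fin 5 → Fin 5 → ℝ} (hM : IsTable M) (g h : Dih) :
    IsTable fun i j => M (act g i) (act h j) where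
  row i := (hM.row (act g i)).comp_act h
  col j := (hM.col (act h j)).comp_act g

/-- The zero pattern of a table. -/
def zeros (M : Fin 5 → Fin 5 → ℝ) : Pattern := by
  classical exact fun i j => decide (M i j = 0)

theorem zeros_iff {M : Fin 5 → Fin 5 → ℝ} {i j : Fin 5} : zeros M i j = true ↔ M i j = 0 := by
  simp [zeros]

theorem zeros_le_iff {M N : Fin 5 → Fin 5 → ℝ} :
    zeros M ≤ zeros N ↔ ∀ i j, M i j = 0 → N i j = 0 := by
  simp only [Pi.le_def, Bool.le_iff_imp, zeros_iff]

theorem zeros_comp_act (M : Fin 5 → Fin 5 → ℝ) (g h : Dih) :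
    zeros (fun i j => M (act g i) (act h j)) = (zeros M).pull g h := rfl

theorem le_zeros_iff {M : Fin 5 → Fin 5 → ℝ} {y : Pattern} :
    y ≤ zeros M ↔ ∀ i j, y i j = true → M i j = 0 := by
  simp only [Pi.le_def, Bool.le_iff_imp, zeros_iff]

/-! ### Linear identities between table entries and the resulting closure rules. -/

theorem IsPentagonal.apply_three {a : Fin 5 → ℝ} (ha : IsPentagonal a) :
    a 3 = a 0 + φ * (a 2 - a 1) := by
  have h0 : a 3 - a 0 = φ * (a 2 - a 1) := ha 0
  linear_combination h0

theorem IsPentagonal.apply_four {a : Fin 5 → ℝ} (ha : IsPentagonal a) :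
    a 4 = φ * (a 0 - a 1) + a 2 := by
  have h0 : a 3 - a 0 = φ * (a 2 - a 1) := ha 0
  have h1 : a 4 - a 1 = φ * (a 3 - a 2) := ha 1
  linear_combination h1 + φ * h0 + (a 2 - a 1) * golden_sq

/-- The source cells stand on the left and the forced cells on the right, all with positive
coefficients; in a nonnegative table, vanishing on the left forces vanishing on the right.
`identity₂` serves the second rule in the same way. -/
theorem IsTable.identity₁ {M : Fin 5 → Fin 5 → ℝ} (hM : IsTable M) :
    φ * M 0 0 + (1 + φ) * M 1 1 + M 2 3 + φ * M 4 2 =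
      (1 + φ) * M 0 1 + φ * M 1 0 + φ * M 2 2 + M 4 3 := by
  have r2 := (hM.row 2).apply_three
  have r4 := (hM.row 4).apply_three
  have c0 : M 4 0 = φ * (M 0 0 - M 1 0) + M 2 0 := (hM.col 0).apply_four
  have c1 : M 4 1 = φ * (M 0 1 - M 1 1) + M 2 1 := (hM.col 1).apply_four
  have c2 : M 4 2 = φ * (M 0 2 - M 1 2) + M 2 2 := (hM.col 2).apply_four
  rw [r2, r4, c0, c1, c2]
  linear_combination (M 0 1 - M 1 1) * golden_sq

theorem IsTable.identity₂ {M : Fin 5 → Fin 5 → ℝ} (hM : IsTable M) :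
    (1 + φ) * M 0 0 + (1 + φ) * M 1 1 + M 2 4 + M 4 2 =
      (1 + φ) * M 0 1 + (1 + φ) * M 1 0 + M 2 2 + M 4 4 := by
  have r2 := (hM.row 2).apply_four
  have r4 := (hM.row 4).apply_four
  have c0 : M 4 0 = φ * (M 0 0 - M 1 0) + M 2 0 := (hM.col 0).apply_four
  have c1 : M 4 1 = φ * (M 0 1 - M 1 1) + M 2 1 := (hM.col 1).apply_four
  have c2 : M 4 2 = φ * (M 0 2 - M 1 2) + M 2 2 := (hM.col 2).apply_four
  rw [r2, r4, c0, c1, c2]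
  linear_combination (M 0 1 + M 1 0 - M 0 0 - M 1 1) * golden_sq

/-- The cells are (i, 2i). A table has only Fourier frequencies 0 and ±1 in each index, and a + 2b
is divisible by 5 for such a, b only if both are 0; so the sum along this transversal sees only the
mean. -/
theorem IsTable.identity₃ {M : Fin 5 → Fin 5 → ℝ} (hM : IsTable M) :
    5 * (M 0 0 + M 1 2 + M 2 4 + M 3 1 + M 4 3) = ∑ i, ∑ j, M i j := by
  have r (i : Fin 5) := (hM.row i).apply_three
  have r' (i : Fin 5) := (hM.row i).apply_four
  have c (j : Fin 5) : M 3 j = M 0 j + φ * (M 2 j - M 1 j) := (hM.col j).apply_three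
  have c' (j : Fin 5) : M 4 j = φ * (M 0 j - M 1 j) + M 2 j := (hM.col j).apply_four
  simp only [Fin.sum_univ_five, r, r', c, c']
  ring_nf
  simp only [golden_sq]
  ring_nf

theorem IsTable.saturated {M : Fin 5 → Fin 5 → ℝ} (hM : IsTable M) (h0 : ∀ i j, 0 ≤ M i j)
    (hs : ∀ g h : Dih, ∑ i, ∑ j, M (act g i) (act h j) ≠ 0) : Saturated (zeros M) := by
  have hφ := golden_pos
  refine ⟨?_, ?_, ?_, ?_, ?_⟩
  · intro i j h h' k
    rw [zeros_iff] at *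
    exact (hM.row i).eq_zero (h0 i) h h' k
  · intro i j h h' k
    rw [zeros_iff] at *
    exact (hM.col j).eq_zero (fun i => h0 i j) h h' k
  · intro g h H
    -- The permutation is moved from the rule to the table, so that the identity is needed in
    -- standard position only.
    rw [Pattern.pull_le_iff, ← zeros_comp_act, le_zeros_iff] at H ⊢
    have id := (hM.comp_act (dihInv g) (dihInv h)).identity₁
    set N : Fin 5 → Fin 5 → ℝ := fun i j => M (act (dihInv g) i) (act (dihInv h) j) with hN
    have n0 : ∀ i j, 0 ≤ N i j := fun i j => h0 _ _
    rw [H 0 0 rfl, H 1 1 rfl, H 2 3 rfl, H 4 2 rfl] at id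
    have p1 := mul_nonneg hφ.le (n0 0 1)
    have p2 := mul_nonneg hφ.le (n0 1 0)
    have p3 := mul_nonneg hφ.le (n0 2 2)
    have q0 := n0 0 1
    have q1 := n0 4 3
    have k1 : N 0 1 = 0 := by linarith
    have k2 : φ * N 1 0 = 0 := by linarith
    have k3 : φ * N 2 2 = 0 := by linarith
    have k4 : N 4 3 = 0 := by linarith
    have k2 := (mul_eq_zero.1 k2).resolve_left hφ.ne'
    have k3 := (mul_eq_zero.1 k3).resolve_left hφ.ne'
    have cells : ∀ i j, forced₁ i j = true →
        (i, j) = (0, 1) ∨ (i, j) = (1, 0) ∨ (i, j) = (2, 2) ∨ (i, j) = (4, 3) := by decide +kernel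
    intro i j hij
    rcases cells i j hij with e | e | e | e <;> obtain ⟨rfl, rfl⟩ := Prod.mk.inj e <;> assumption
  · intro g h H
    rw [Pattern.pull_le_iff, ← zeros_comp_act, le_zeros_iff] at H ⊢
    have id := (hM.comp_act (dihInv g) (dihInv h)).identity₂
    set N : Fin 5 → Fin 5 → ℝ := fun i j => M (act (dihInv g) i) (act (dihInv h) j) with hN
    have n0 : ∀ i j, 0 ≤ N i j := fun i j => h0 _ _
    rw [H 0 0 rfl, H 1 1 rfl, H 2 4 rfl, H 4 2 rfl] at id
    have p1 := mul_nonneg hφ.le (n0 0 1)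
    have p2 := mul_nonneg hφ.le (n0 1 0)
    have q0 := n0 0 1
    have q1 := n0 1 0
    have q2 := n0 2 2
    have q3 := n0 4 4
    have k1 : N 0 1 = 0 := by linarith
    have k2 : N 1 0 = 0 := by linarith
    have k3 : N 2 2 = 0 := by linarith
    have k4 : N 4 4 = 0 := by linarith
    have cells : ∀ i j, forced₂ i j = true →
        (i, j) = (0, 1) ∨ (i, j) = (1, 0) ∨ (i, j) = (2, 2) ∨ (i, j) = (4, 4) := by decide +kernel
    intro i j hij
    rcases cells i j hij with e | e | e | e <;> obtain ⟨rfl, rfl⟩ := Prod.mk.inj e <;> assumption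
  · intro g h H
    rw [Pattern.pull_le_iff, ← zeros_comp_act, le_zeros_iff] at H
    refine hs (dihInv g) (dihInv h) ?_
    rw [← (hM.comp_act (dihInv g) (dihInv h)).identity₃, H 0 0 rfl, H 1 2 rfl, H 2 4 rfl, H 3 1 rfl,
      H 4 3 rfl]
    ring

/-! ### The vertices of the pentagon -/

theorem cos_pi_div_five_eq : Real.cos (Real.pi / 5) = φ / 2 := by
  rw [Real.cos_pi_div_five, golden, Real.goldenRatio]
  ring

theorem radius_sq : radius 5 ^ 2 = 2 * (φ - 1) := by
  have h : (1 : ℝ) / Real.cos (Real.pi / (5 : ℕ)) = 2 * (φ - 1) := by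
    have := golden_pos
    have e : Real.cos (Real.pi / (5 : ℕ)) = φ / 2 := by exact_mod_cast cos_pi_div_five_eq
    rw [e]
    field_simp
    linear_combination - golden_sq
  rw [radius, h, Real.sq_sqrt]
  linarith [one_lt_golden]

theorem radius_pos : 0 < radius 5 := by
  have h : radius 5 ≠ 0 := by
    intro h
    have := radius_sq
    rw [h] at this
    linarith [one_lt_golden]
  exact lt_of_le_of_ne (Real.sqrt_nonneg _) h.symm

theorem sin_sq_eq : σ ^ 2 = (3 - φ) / 4 := by
  rw [Real.sin_sq, cos_pi_div_five_eq]
  linear_combination - golden_sq / 4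

theorem sin_pos : 0 < σ := Real.sin_pos_of_pos_of_lt_pi (by positivity) (by linarith [Real.pi_pos])

/-- The pure states, indexed by `Fin 5`. -/
def vertex (i : Fin 5) : Vec := pureState 5 i.val

theorem cos_two : Real.cos (2 * (Real.pi / 5)) = (φ - 1) / 2 := by
  rw [Real.cos_two_mul, cos_pi_div_five_eq]
  linear_combination golden_sq / 2

theorem sin_two : Real.sin (2 * (Real.pi / 5)) = φ * σ := by
  rw [Real.sin_two_mul, cos_pi_div_five_eq]
  ring

theorem vertex_zero : vertex 0 = ![radius 5, 0, 1] := by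
  simp [vertex, pureState]

theorem vertex_one : vertex 1 = ![radius 5 * ((φ - 1) / 2), radius 5 * (φ * σ), 1] := by
  have e : 2 * Real.pi * ((1 : ℕ) : ℝ) / (5 : ℕ) = 2 * (Real.pi / 5) := by push_cast; ring
  change pureState 5 1 = _
  rw [pureState, e, cos_two, sin_two]

theorem vertex_two : vertex 2 = ![radius 5 * (-φ / 2), radius 5 * σ, 1] := by
  have e : 2 * Real.pi * ((2 : ℕ) : ℝ) / (5 : ℕ) = Real.pi - Real.pi / 5 := by push_cast; ring
  change pureState 5 2 = _
  rw [pureState, e, Real.cos_pi_sub, Real.sin_pi_sub, cos_pi_div_five_eq, neg_div]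

theorem vertex_three : vertex 3 = ![radius 5 * (-φ / 2), radius 5 * -σ, 1] := by
  have e : 2 * Real.pi * ((3 : ℕ) : ℝ) / (5 : ℕ) = Real.pi / 5 + Real.pi := by push_cast; ring
  change pureState 5 3 = _
  rw [pureState, e, Real.cos_add_pi, Real.sin_add_pi, cos_pi_div_five_eq, neg_div]

theorem vertex_four : vertex 4 = ![radius 5 * ((φ - 1) / 2), radius 5 * (-(φ * σ)), 1] := by
  have e : 2 * Real.pi * ((4 : ℕ) : ℝ) / (5 : ℕ) = 2 * Real.pi - 2 * (Real.pi / 5) := by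
    push_cast; ring
  change pureState 5 4 = _
  rw [pureState, e, Real.cos_two_pi_sub, Real.sin_two_pi_sub, cos_two, sin_two]

/-- The horizontal coordinates of the vertices, in units of `radius 5`. -/
def vertexCos : Fin 5 → ℝ := ![1, (φ - 1) / 2, -φ / 2, -φ / 2, (φ - 1) / 2]

/-- The vertical coordinates of the vertices, in units of `radius 5 * sin (π / 5)`. -/
def vertexSin : Fin 5 → ℝ := ![0, φ, 1, -1, -φ]

theorem vertex_eq (i : Fin 5) :
    vertex i = ![radius 5 * vertexCos i, radius 5 * (vertexSin i * σ), 1] := by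
  fin_cases i
  · simpa [vertexCos, vertexSin] using vertex_zero
  · simpa [vertexCos, vertexSin] using vertex_one
  · simpa [vertexCos, vertexSin] using vertex_two
  · simpa [vertexCos, vertexSin] using vertex_three
  · simpa [vertexCos, vertexSin] using vertex_four

theorem isPentagonal_vertexCos : IsPentagonal vertexCos := by
  intro j
  fin_cases j <;> simp [vertexCos]
  · linear_combination golden_sq
  · linear_combination - golden_sq
  · linear_combination golden_sq / 2
  · linear_combination - golden_sq / 2

theorem isPentagonal_vertexSin : IsPentagonal vertexSin := by
  intro j
  fin_cases j <;> simp [vertexSin]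
  · linear_combination golden_sq
  · ring
  · linear_combination golden_sq
  · linear_combination - golden_sq
  · linear_combination - golden_sq

/-- The diagonal from vertex j to vertex j + 3 is parallel to the side from j + 1 to j + 2 and φ
times as long. -/
theorem isPentagonal_dotProduct (e : Vec) : IsPentagonal fun j => e ⬝ᵥ vertex j := by
  intro j
  have hc := isPentagonal_vertexCos j
  have hs := isPentagonal_vertexSin j
  simp only [vertex_eq, dotProduct, Fin.sum_univ_three, cons_val_zero, cons_val_one, cons_val]
  linear_combination e 0 * radius 5 * hc + e 1 * radius 5 * σ * hs

/-- The values of a bipartite state on pairs of vertices. -/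
def table (Φ : BiVec) (i j : Fin 5) : ℝ := prodEffect (vertex i) (vertex j) Φ

theorem prodEffect_eq (e f : Vec) (Φ : BiVec) : prodEffect e f Φ = f ⬝ᵥ (Φᵀ *ᵥ e) := by
  rw [prodEffect, dotProduct_mulVec, ← mulVec_transpose, dotProduct_comm]

theorem isTable_table (Φ : BiVec) : IsTable (table Φ) where
  row i := by
    intro j
    have := isPentagonal_dotProduct (Φᵀ *ᵥ vertex i) j
    simpa only [table, prodEffect_eq, dotProduct_comm] using this
  col j := by
    intro i
    have := isPentagonal_dotProduct (Φ *ᵥ vertex j) i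
    simpa only [table, prodEffect, dotProduct_comm] using this

/-! ### The maximal tensor product in terms of tables -/

theorem dotProduct_vertex (e : Vec) (i : Fin 5) :
    e ⬝ᵥ vertex i = radius 5 * (e 0 * vertexCos i) + radius 5 * σ * (e 1 * vertexSin i) + e 2 := by
  simp only [vertex_eq, dotProduct, Fin.sum_univ_three, cons_val_zero, cons_val_one, cons_val]
  ring

theorem eq_of_dotProduct_vertex {x y : Vec} (h : ∀ i, x ⬝ᵥ vertex i = y ⬝ᵥ vertex i) : x = y := by
  have hr := radius_pos
  have hs := mul_pos radius_pos sin_pos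
  simp only [dotProduct_vertex] at h
  have h0 := h 0
  have h1 := h 1
  have h2 := h 2
  have h3 := h 3
  have h4 := h 4
  simp [vertexCos, vertexSin] at h0 h1 h2 h3 h4
  have e2 : x 2 = y 2 := by linear_combination (h0 + h1 + h2 + h3 + h4) / 5
  have e0 : x 0 = y 0 := by
    have : radius 5 * (x 0 - y 0) = 0 := by linear_combination h0 - e2
    linarith [(mul_eq_zero.1 this).resolve_left hr.ne']
  have e1 : x 1 = y 1 := by
    have : radius 5 * σ * (x 1 - y 1) = 0 := by linear_combination (h2 - h3) / 2
    linarith [(mul_eq_zero.1 this).resolve_left hs.ne']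
  ext k
  fin_cases k <;> assumption

/-- The inner products of the vertices, as a function of the difference of the indices. -/
def gram : Fin 5 → ℝ := ![2 * φ - 1, 3 - φ, 0, 0, 3 - φ]

theorem radius_sin_sq : radius 5 ^ 2 * σ ^ 2 = (3 * φ - 4) / 2 := by
  rw [radius_sq, sin_sq_eq]
  linear_combination - golden_sq / 2

theorem golden_cube : φ ^ 3 = 2 * φ + 1 := by
  linear_combination (φ + 1) * golden_sq

/-- The radius is such that $r^2\cos(4\pi/5)=-1$: non-adjacent vertices are orthogonal, which is the
source of self-duality and of all zeros in the tables. -/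
theorem vertex_dotProduct_vertex (i j : Fin 5) : vertex i ⬝ᵥ vertex j = gram (i - j) := by
  have e : vertex i ⬝ᵥ vertex j = radius 5 ^ 2 * (vertexCos i * vertexCos j) +
      radius 5 ^ 2 * σ ^ 2 * (vertexSin i * vertexSin j) + 1 := by
    rw [dotProduct_vertex]
    simp only [vertex_eq, cons_val_zero, cons_val_one, cons_val]
    ring
  rw [e, radius_sin_sq, radius_sq]
  fin_cases i <;> fin_cases j <;> simp [vertexCos, vertexSin, gram, Fin.sub_def] <;> ring_nf <;>
    simp only [golden_sq, golden_cube] <;> ring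

theorem gram_nonneg (i : Fin 5) : 0 ≤ gram i ∧ gram i ≤ 2 * φ - 1 := by
  have h1 := one_lt_golden
  have h2 : φ < 2 := Real.goldenRatio_lt_two
  have h3 : 4 ≤ 3 * φ := by nlinarith [golden_sq]
  fin_cases i <;> simp [gram] <;> first | constructor <;> linarith | linarith

theorem image_pureState : pureState 5 '' Set.Icc 1 5 = Set.range vertex := by
  have h5 : pureState 5 5 = vertex 0 := by
    have e : 2 * Real.pi * ((5 : ℕ) : ℝ) / (5 : ℕ) = 2 * Real.pi := by push_cast; ring
    rw [pureState, e, vertex_zero, Real.cos_two_pi, Real.sin_two_pi, mul_one, mul_zero]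
  ext x
  constructor
  · rintro ⟨k, ⟨hk1, hk5⟩, rfl⟩
    interval_cases k
    exacts [⟨1, rfl⟩, ⟨2, rfl⟩, ⟨3, rfl⟩, ⟨4, rfl⟩, ⟨0, h5.symm⟩]
  · rintro ⟨i, rfl⟩
    by_cases hi : i = 0
    · exact ⟨5, by simp, by rw [hi, h5]⟩
    · refine ⟨i.val, ⟨?_, i.isLt.le⟩, rfl⟩
      exact Nat.one_le_iff_ne_zero.2 fun h => hi (Fin.ext h)

theorem vertex_mem_stateSpace (i : Fin 5) : vertex i ∈ stateSpace 5 := by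
  rw [stateSpace, image_pureState]
  exact subset_convexHull ℝ _ ⟨i, rfl⟩

theorem mem_effectSpace_iff {e : Vec} :
    e ∈ effectSpace 5 ↔ ∀ i, 0 ≤ e ⬝ᵥ vertex i ∧ e ⬝ᵥ vertex i ≤ 1 := by
  refine ⟨fun h i => h _ (vertex_mem_stateSpace i), fun h ω hω => ?_⟩
  have hconv : Convex ℝ {ω : Vec | 0 ≤ e ⬝ᵥ ω ∧ e ⬝ᵥ ω ≤ 1} := by
    intro x hx y hy a b ha hb hab
    simp only [Set.mem_ofPred_eq, dotProduct_add, dotProduct_smul, smul_eq_mul] at *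
    constructor
    · exact add_nonneg (mul_nonneg ha hx.1) (mul_nonneg hb hy.1)
    · calc a * (e ⬝ᵥ x) + b * (e ⬝ᵥ y) ≤ a * 1 + b * 1 := by gcongr <;> tauto
        _ = 1 := by linarith
  rw [stateSpace, image_pureState] at hω
  refine convexHull_min ?_ hconv hω
  rintro _ ⟨i, rfl⟩
  exact h i

theorem smul_vertex_mem_effectSpace (i : Fin 5) :
    (2 * φ - 1)⁻¹ • vertex i ∈ effectSpace 5 := by
  have h : 0 < 2 * φ - 1 := by linarith [one_lt_golden]
  refine mem_effectSpace_iff.2 fun j => ?_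
  obtain ⟨h0, h1⟩ := gram_nonneg (i - j)
  rw [smul_dotProduct, vertex_dotProduct_vertex, smul_eq_mul]
  exact ⟨mul_nonneg (inv_nonneg.2 h.le) h0, by rwa [inv_mul_le_one₀ h]⟩

/-- The dual cone of the pentagon is spanned by the vertices. -/
theorem exists_eq_sum_vertex {e : Vec} (he : ∀ i, 0 ≤ e ⬝ᵥ vertex i) :
    ∃ c : Fin 5 → ℝ, (∀ i, 0 ≤ c i) ∧ e = ∑ i, c i • vertex i := by
  have hφ := golden_pos
  have h2 : φ < 2 := Real.goldenRatio_lt_two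
  have h1 := one_lt_golden
  have hp := isPentagonal_dotProduct e
  set a : Fin 5 → ℝ := fun j => e ⬝ᵥ vertex j with ha
  have p3 : a 3 = a 0 + φ * (a 2 - a 1) := hp.apply_three
  have p4 : a 4 = φ * (a 0 - a 1) + a 2 := hp.apply_four
  have key : ∀ c : Fin 5 → ℝ, (∀ j, a j = ∑ i, c i * gram (i - j)) → e = ∑ i, c i • vertex i := by
    intro c hc
    refine eq_of_dotProduct_vertex fun j => ?_
    rw [sum_dotProduct]
    simp only [smul_dotProduct, smul_eq_mul, vertex_dotProduct_vertex]
    exact hc j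
  have a0 : ∀ i, 0 ≤ a i := he
  clear_value a
  -- The cone is cut by the fan triangulation of the pentagon from vertex 0, into triangles 012, 034
  -- and 023. The tested quantities are, up to a positive factor, the coordinates at vertices 3 and
  -- 2 relative to triangle 023; the witnesses are the coordinates in the triangle containing `e`.
  by_cases c1 : a 4 - a 1 + a 3 < 0
  · refine ⟨![a 4 * ((2 + φ) / 5), (a 1 - a 4 - a 3) * ((2 * φ - 1) / 5), a 3 * ((2 + φ) / 5), 0, 0],
      ?_, key _ ?_⟩
    · intro i
      fin_cases i <;> simp
      · exact mul_nonneg (a0 4) (by linarith)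
      · exact mul_nonneg (by linarith) (by linarith)
      · exact mul_nonneg (a0 3) (by linarith)
    · intro j
      fin_cases j <;> simp [Fin.sum_univ_five, gram, Fin.sub_def, p3, p4] <;> ring_nf <;>
        simp only [golden_sq, golden_cube] <;> ring
  by_cases c2 : a 1 - a 4 + a 2 < 0
  · refine ⟨![a 1 * ((2 + φ) / 5), 0, 0, a 2 * ((2 + φ) / 5), (a 4 - a 1 - a 2) * ((2 * φ - 1) / 5)],
      ?_, key _ ?_⟩
    · intro i
      fin_cases i <;> simp
      · exact mul_nonneg (a0 1) (by linarith)
      · exact mul_nonneg (a0 2) (by linarith)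
      · exact mul_nonneg (by linarith) (by linarith)
    · intro j
      fin_cases j <;> simp [Fin.sum_univ_five, gram, Fin.sub_def, p3, p4] <;> ring_nf <;>
        simp only [golden_sq, golden_cube] <;> ring
  · refine ⟨![a 0 * ((2 * φ - 1) / 5), 0, (a 1 - a 4 + a 2) * ((3 - φ) / 5),
      (a 4 - a 1 + a 3) * ((3 - φ) / 5), 0], ?_, key _ ?_⟩
    · intro i
      fin_cases i <;> simp
      · exact mul_nonneg (a0 0) (by linarith)
      · exact mul_nonneg (by linarith) (by linarith)
      · exact mul_nonneg (by linarith) (by linarith)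
    · intro j
      fin_cases j <;> simp [Fin.sum_univ_five, gram, Fin.sub_def, p3, p4] <;> ring_nf <;>
        simp only [golden_sq, golden_cube] <;> ring

theorem prodEffect_sum (c d : Fin 5 → ℝ) (Φ : BiVec) :
    prodEffect (∑ i, c i • vertex i) (∑ j, d j • vertex j) Φ =
      ∑ i, ∑ j, c i * d j * table Φ i j := by
  simp only [prodEffect, table, sum_dotProduct, mulVec_sum, dotProduct_sum, mulVec_smul,
    smul_dotProduct, dotProduct_smul, smul_eq_mul, Finset.mul_sum]
  rw [Finset.sum_comm]
  exact Finset.sum_congr rfl fun i _ => Finset.sum_congr rfl fun j _ => by ring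

theorem sum_vertex : unitEffect = ∑ i, (5 : ℝ)⁻¹ • vertex i := by
  ext k
  fin_cases k <;> simp [unitEffect, Fin.sum_univ_five, vertex_zero, vertex_one, vertex_two,
    vertex_three, vertex_four] <;> ring

theorem prodEffect_unitEffect (Φ : BiVec) :
    prodEffect unitEffect unitEffect Φ = 25⁻¹ * ∑ i, ∑ j, table Φ i j := by
  rw [sum_vertex, prodEffect_sum, Finset.mul_sum]
  refine Finset.sum_congr rfl fun i _ => ?_
  rw [Finset.mul_sum]
  exact Finset.sum_congr rfl fun j _ => by norm_num

/-- Scaled vertices are effects and every effect is a nonnegative combination of vertices, so 25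
inequalities suffice. The unit effect is the mean of the vertices, which turns normalization into
total 25. -/
theorem mem_maxTensor_iff {Φ : BiVec} :
    Φ ∈ maxTensor 5 ↔ (∀ i j, 0 ≤ table Φ i j) ∧ ∑ i, ∑ j, table Φ i j = 25 := by
  refine and_congr ⟨fun h i j => ?_, fun h e he f hf => ?_⟩ ?_
  · have hp : 0 < (2 * φ - 1)⁻¹ := inv_pos.2 (by linarith [one_lt_golden])
    have := h _ (smul_vertex_mem_effectSpace i) _ (smul_vertex_mem_effectSpace j)
    simp only [prodEffect, smul_dotProduct, mulVec_smul, dotProduct_smul, smul_eq_mul] at this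
    exact nonneg_of_mul_nonneg_right (nonneg_of_mul_nonneg_right this hp) hp
  · obtain ⟨c, hc, rfl⟩ := exists_eq_sum_vertex fun i => (mem_effectSpace_iff.1 he i).1
    obtain ⟨d, hd, rfl⟩ := exists_eq_sum_vertex fun i => (mem_effectSpace_iff.1 hf i).1
    rw [prodEffect_sum]
    exact Finset.sum_nonneg fun i _ => Finset.sum_nonneg fun j _ =>
      mul_nonneg (mul_nonneg (hc i) (hd j)) (h i j)
  · rw [prodEffect_unitEffect]
    constructor <;> intro h <;> linarith

/-- The bijection of the vertices given by `act`. -/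
def actEquiv (g : Dih) : Fin 5 ≃ Fin 5 where
  toFun := act g
  invFun := act (dihInv g)
  left_inv := dihInv_act g
  right_inv := act_dihInv g

theorem sum_act (M : Fin 5 → Fin 5 → ℝ) (g h : Dih) :
    ∑ i, ∑ j, M (act g i) (act h j) = ∑ i, ∑ j, M i j := by
  rw [← Equiv.sum_comp (actEquiv g) fun i => ∑ j, M i j]
  refine Finset.sum_congr rfl fun i _ => ?_
  exact Equiv.sum_comp (actEquiv h) (M (act g i))

theorem saturated_zeros_table {Φ : BiVec} (hΦ : Φ ∈ maxTensor 5) : Saturated (zeros (table Φ)) := by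
  obtain ⟨h0, hs⟩ := mem_maxTensor_iff.1 hΦ
  refine (isTable_table Φ).saturated h0 fun g h => ?_
  rw [sum_act, hs]
  norm_num

theorem table_injective : Function.Injective table := by
  intro Φ Ψ h
  have h1 : ∀ j, Φ *ᵥ vertex j = Ψ *ᵥ vertex j := fun j => by
    refine eq_of_dotProduct_vertex fun i => ?_
    rw [dotProduct_comm, dotProduct_comm _ (vertex i)]
    exact congrFun (congrFun h i) j
  ext k l
  have : Φ k = Ψ k := eq_of_dotProduct_vertex fun j => congrFun (h1 j) k
  exact congrFun this l

/-- The table of a bipartite state, as a linear map. -/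
def tableLinear : BiVec →ₗ[ℝ] Fin 5 → Fin 5 → ℝ where
  toFun := table
  map_add' Φ Ψ := by
    funext i j
    simp [table, prodEffect, add_mulVec, dotProduct_add]
  map_smul' c Φ := by
    funext i j
    simp [table, prodEffect, smul_mulVec, dotProduct_smul]

theorem table_add (Φ Ψ : BiVec) (i j : Fin 5) : table (Φ + Ψ) i j = table Φ i j + table Ψ i j :=
  congrFun (congrFun (tableLinear.map_add Φ Ψ) i) j

theorem table_smul (c : ℝ) (Φ : BiVec) (i j : Fin 5) : table (c • Φ) i j = c * table Φ i j :=
  congrFun (congrFun (tableLinear.map_smul c Φ) i) j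

/-! ### The action of the reversible transformations -/

theorem cos_vertex (k : Fin 5) : Real.cos (2 * Real.pi * (k.val : ℕ) / (5 : ℕ)) = vertexCos k := by
  have h : radius 5 * Real.cos (2 * Real.pi * (k.val : ℕ) / (5 : ℕ)) = radius 5 * vertexCos k :=
    congrFun (vertex_eq k) 0
  exact mul_left_cancel₀ radius_pos.ne' h

theorem sin_vertex (k : Fin 5) :
    Real.sin (2 * Real.pi * (k.val : ℕ) / (5 : ℕ)) = vertexSin k * σ := by
  have h : radius 5 * Real.sin (2 * Real.pi * (k.val : ℕ) / (5 : ℕ)) =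
      radius 5 * (vertexSin k * σ) := congrFun (vertex_eq k) 1
  exact mul_left_cancel₀ radius_pos.ne' h

theorem vertexCos_sub (i k : Fin 5) : vertexCos (i - k) =
    vertexCos i * vertexCos k + vertexSin i * vertexSin k * σ ^ 2 := by
  rw [sin_sq_eq]
  fin_cases i <;> fin_cases k <;> simp [vertexCos, vertexSin, Fin.sub_def] <;> ring_nf <;>
    simp only [golden_sq, golden_cube] <;> ring

theorem vertexSin_sub (i k : Fin 5) : vertexSin (i - k) =
    vertexSin i * vertexCos k - vertexCos i * vertexSin k := by
  fin_cases i <;> fin_cases k <;> simp [vertexCos, vertexSin, Fin.sub_def] <;> ring_nf <;>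
    simp only [golden_sq] <;> ring

/-- The reversible transformation with index `g`. -/
def transform (g : Dih) : Matrix (Fin 3) (Fin 3) ℝ :=
  transformation 5 g.1.val (bif g.2 then 1 else -1)

theorem transpose_transform_mulVec_vertex (g : Dih) (i : Fin 5) :
    (transform g)ᵀ *ᵥ vertex i = vertex (act g i) := by
  obtain ⟨k, b⟩ := g
  ext l
  cases b
  · fin_cases l <;> simp only [transform, transformation, cos_vertex, sin_vertex, act, vertex_eq,
      cond_false, mulVec, dotProduct, Fin.sum_univ_three, transpose_apply, vertexCos_sub,
      vertexSin_sub] <;> simp <;> ring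
  · fin_cases l <;> simp only [transform, transformation, cos_vertex, sin_vertex, act, vertex_eq,
      cond_true, mulVec, dotProduct, Fin.sum_univ_three, transpose_apply, vertexCos_sub,
      vertexSin_sub] <;> simp <;> ring

theorem reversible_eq : reversible 5 = Set.range transform := by
  ext T
  constructor
  · rintro ⟨k, ⟨hk1, hk5⟩, s, hs, rfl⟩
    -- Rotation numbers run over 1, …, 5 in the definition and over 0, …, 4 here; 5 and 0 give the
    -- same angle.
    have h : ∃ l : Fin 5, transformation 5 k s = transformation 5 l.val s := by
      rcases hk5.lt_or_eq with h | rfl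
      · exact ⟨⟨k, h⟩, rfl⟩
      · refine ⟨0, ?_⟩
        have e : 2 * Real.pi * ((5 : ℕ) : ℝ) / (5 : ℕ) = 2 * Real.pi := by push_cast; ring
        simp only [transformation, e, Real.cos_two_pi, Real.sin_two_pi]
        simp
    obtain ⟨l, hl⟩ := h
    rcases hs with rfl | rfl
    · exact ⟨(l, true), hl.symm⟩
    · exact ⟨(l, false), hl.symm⟩
  · rintro ⟨⟨l, b⟩, rfl⟩
    have hs : ∀ b : Bool, (bif b then (1 : ℝ) else -1) = 1 ∨ (bif b then (1 : ℝ) else -1) = -1 := by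
      intro b
      cases b <;> simp
    by_cases hl : l = 0
    · refine ⟨5, by simp, _, hs b, ?_⟩
      have e : 2 * Real.pi * ((5 : ℕ) : ℝ) / (5 : ℕ) = 2 * Real.pi := by push_cast; ring
      simp only [transform, transformation, e, Real.cos_two_pi, Real.sin_two_pi, hl]
      simp
    · exact ⟨l.val, ⟨Nat.one_le_iff_ne_zero.2 fun h => hl (Fin.ext h), l.isLt.le⟩, _, hs b, rfl⟩

theorem table_transform (g h : Dih) (Φ : BiVec) (i j : Fin 5) :
    table (transform g * Φ * (transform h)ᵀ) i j = table Φ (act g i) (act h j) := by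
  rw [table, table, prodEffect, prodEffect, ← transpose_transform_mulVec_vertex,
    ← transpose_transform_mulVec_vertex, ← mulVec_mulVec, ← mulVec_mulVec, dotProduct_mulVec,
    ← mulVec_transpose]

theorem locallyEquivalent_iff {Φ Ψ : BiVec} : LocallyEquivalent 5 Φ Ψ ↔
    ∃ g h, ∀ i j, table Ψ i j = table Φ (act g i) (act h j) := by
  rw [LocallyEquivalent, reversible_eq]
  constructor
  · rintro ⟨_, ⟨g, rfl⟩, _, ⟨h, rfl⟩, rfl⟩
    exact ⟨g, h, table_transform g h Φ⟩
  · rintro ⟨g, h, H⟩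
    refine ⟨_, ⟨g, rfl⟩, _, ⟨h, rfl⟩, table_injective ?_⟩
    funext i j
    rw [H, table_transform]

theorem equivalence_locallyEquivalent : Equivalence (LocallyEquivalent 5) where
  refl Φ := locallyEquivalent_iff.2 ⟨(0, true), (0, true), fun i j => by simp [act]⟩
  symm {Φ Ψ} H := by
    obtain ⟨g, h, H⟩ := locallyEquivalent_iff.1 H
    exact locallyEquivalent_iff.2 ⟨dihInv g, dihInv h, fun i j => by
      rw [H, act_dihInv, act_dihInv]⟩
  trans {Φ Ψ Θ} H H' := by
    obtain ⟨g, h, H⟩ := locallyEquivalent_iff.1 H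
    obtain ⟨g', h', H'⟩ := locallyEquivalent_iff.1 H'
    exact locallyEquivalent_iff.2 ⟨dihComp g g', dihComp h h', fun i j => by
      rw [H', H, act_dihComp, act_dihComp]⟩

theorem LocallyEquivalent.mem_maxTensor {Φ Ψ : BiVec} (H : LocallyEquivalent 5 Φ Ψ)
    (hΦ : Φ ∈ maxTensor 5) : Ψ ∈ maxTensor 5 := by
  obtain ⟨g, h, H⟩ := locallyEquivalent_iff.1 H
  obtain ⟨h0, h1⟩ := mem_maxTensor_iff.1 hΦ
  refine mem_maxTensor_iff.2 ⟨fun i j => H i j ▸ h0 _ _, ?_⟩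
  simp only [H]
  rw [sum_act, h1]

theorem LocallyEquivalent.zeros_mem_orbit {Φ Ψ : BiVec} (H : LocallyEquivalent 5 Φ Ψ) :
    zeros (table Ψ) ∈ (zeros (table Φ)).orbit := by
  obtain ⟨g, h, H⟩ := locallyEquivalent_iff.1 H
  refine ⟨g, h, ?_⟩
  rw [← zeros_comp_act]
  exact congrArg zeros (funext fun i => funext (H i))

theorem exists_locallyEquivalent (Φ : BiVec) {y : Pattern} (hy : y ∈ (zeros (table Φ)).orbit) :
    ∃ Ψ, LocallyEquivalent 5 Φ Ψ ∧ zeros (table Ψ) = y := by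
  obtain ⟨g, h, rfl⟩ := hy
  refine ⟨transform g * Φ * (transform h)ᵀ, locallyEquivalent_iff.2
    ⟨g, h, table_transform g h Φ⟩, ?_⟩
  rw [← zeros_comp_act]
  exact congrArg zeros (funext fun i => funext (table_transform g h Φ i))

/-! ### The three representatives -/

theorem gram_eq_zero_iff (i : Fin 5) : gram i = 0 ↔ i = 2 ∨ i = 3 := by
  have h1 := one_lt_golden
  have h2 : φ < 2 := Real.goldenRatio_lt_two
  fin_cases i <;> simp [gram] <;> intro h <;> linarith

/-- A product of two vertices. -/
def phiP : BiVec := tensor (vertex 0) (vertex 0)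

theorem table_tensor (ω η : Vec) (i j : Fin 5) :
    table (tensor ω η) i j = (vertex i ⬝ᵥ ω) * (vertex j ⬝ᵥ η) := prodEffect_tensor _ _ _ _

theorem table_phiP (i j : Fin 5) : table phiP i j = gram i * gram j := by
  rw [phiP, table_tensor, vertex_dotProduct_vertex, vertex_dotProduct_vertex, sub_zero, sub_zero]

theorem table_phiJ (i j : Fin 5) : table phiJ i j = gram (i - j) := by
  have : phiJ = 1 := by
    ext i j
    fin_cases i <;> fin_cases j <;> simp [phiJ]
  rw [table, prodEffect, this, one_mulVec, vertex_dotProduct_vertex]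

/-- The table of `Φ_H`. -/
def tableH : Fin 5 → Fin 5 → ℝ :=
  ![![0, 0, 3 - φ, 2 * φ - 1, 3 - φ], ![0, 7 - 4 * φ, 3 * φ - 4, 7 - 4 * φ, 0],
    ![3 - φ, 3 * φ - 4, 0, 0, 3 * φ - 4], ![2 * φ - 1, 7 - 4 * φ, 0, 3 - φ, 6 - 2 * φ],
    ![3 - φ, 0, 3 * φ - 4, 6 - 2 * φ, 5 * φ - 5]]

theorem table_phiH (i j : Fin 5) : table phiH i j = tableH i j := by
  have hσ := sin_pos
  -- Writing the entries with coefficients in ℚ(φ) leaves only even powers of `radius 5` and σ in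
  -- the table, so all its values lie in ℚ(φ).
  have hB : -radius 5 ^ 6 * σ / (8 * (1 + radius 5 ^ 2)) = (4 * φ - 7) / 5 * σ := by
    rw [div_eq_iff (by positivity), show radius 5 ^ 6 = (radius 5 ^ 2) ^ 3 by ring, radius_sq]
    linear_combination (-(8 * φ - 16 + 64 / 5) * σ) * golden_sq
  have hD : -radius 5 ^ 3 / (4 * σ) = 2 * (1 - 2 * φ) / 5 * (radius 5 * σ) := by
    rw [div_eq_iff (by positivity), show radius 5 ^ 3 = radius 5 * radius 5 ^ 2 by ring, radius_sq]
    linear_combination (-(8 / 5 * (1 - 2 * φ)) * radius 5) * sin_sq_eq -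
      (4 / 5 * radius 5) * golden_sq
  have e : table phiH i j = - (φ / 2) * radius 5 ^ 2 * (vertexCos i * vertexCos j) +
      (4 * φ - 7) / 5 * (radius 5 ^ 2 * σ ^ 2) *
        (vertexCos i * vertexSin j + vertexSin i * vertexCos j) +
      φ / 2 * (radius 5 ^ 2 * σ ^ 2) * (vertexSin i * vertexSin j) +
      2 * (1 - 2 * φ) / 5 * (radius 5 ^ 2 * σ ^ 2) * (vertexSin i + vertexSin j) + 1 := by
    rw [table, prodEffect, phiH, hB, hD, cos_pi_div_five_eq, vertex_eq, vertex_eq]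
    simp only [mulVec, dotProduct, Fin.sum_univ_three]
    simp
    ring
  have e : table phiH i j = - (vertexCos i * vertexCos j) +
      (8 - 5 * φ) / 2 * (vertexCos i * vertexSin j + vertexSin i * vertexCos j) +
      (3 - φ) / 4 * (vertexSin i * vertexSin j) +
      (φ - 2) * (vertexSin i + vertexSin j) + 1 := by
    have h1 : - (φ / 2) * radius 5 ^ 2 = -1 := by
      rw [radius_sq]
      linear_combination - golden_sq
    have h2 : (4 * φ - 7) / 5 * (radius 5 ^ 2 * σ ^ 2) = (8 - 5 * φ) / 2 := by
      rw [radius_sin_sq]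
      linear_combination 6 / 5 * golden_sq
    have h3 : φ / 2 * (radius 5 ^ 2 * σ ^ 2) = (3 - φ) / 4 := by
      rw [radius_sin_sq]
      linear_combination 3 / 4 * golden_sq
    have h4 : 2 * (1 - 2 * φ) / 5 * (radius 5 ^ 2 * σ ^ 2) = φ - 2 := by
      rw [radius_sin_sq]
      linear_combination - 6 / 5 * golden_sq
    rw [e, h1, h2, h3, h4]
    ring
  rw [e]
  fin_cases i <;> fin_cases j <;> simp [vertexCos, vertexSin, tableH] <;> ring_nf <;>
    simp only [golden_sq, golden_cube] <;> ring

theorem golden_bounds : 4 < 3 * φ ∧ 4 * φ < 7 := by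
  have := golden_pos
  constructor <;> nlinarith [golden_sq]

theorem tableH_nonneg (i j : Fin 5) : 0 ≤ tableH i j := by
  obtain ⟨h1, h2⟩ := golden_bounds
  fin_cases i <;> fin_cases j <;> simp [tableH] <;> linarith

theorem zeros_phiP : zeros (table phiP) = patP := by
  have h : ∀ i j, patP i j = true ↔ (i = 2 ∨ i = 3) ∨ (j = 2 ∨ j = 3) := by decide +kernel
  funext i j
  rw [Bool.eq_iff_iff, zeros_iff, table_phiP, mul_eq_zero, gram_eq_zero_iff, gram_eq_zero_iff, h]

theorem zeros_phiJ : zeros (table phiJ) = patJ := by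
  have h : ∀ i j, patJ i j = true ↔ i - j = 2 ∨ i - j = 3 := by decide +kernel
  funext i j
  rw [Bool.eq_iff_iff, zeros_iff, table_phiJ, gram_eq_zero_iff, h]

theorem zeros_phiH : zeros (table phiH) = patH := by
  obtain ⟨h1, h2⟩ := golden_bounds
  have pos : ∀ i j, patH i j = false → tableH i j ≠ 0 := by
    intro i j h
    refine ne_of_gt ?_
    fin_cases i <;> fin_cases j <;> first | exact absurd h (by decide) | (simp [tableH]; linarith)
  have zero : ∀ i j, patH i j = true → tableH i j = 0 := by
    intro i j h
    fin_cases i <;> fin_cases j <;> first | exact absurd h (by decide) | simp [tableH]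
  funext i j
  rw [Bool.eq_iff_iff, zeros_iff, table_phiH]
  refine ⟨fun h => ?_, zero i j⟩
  by_contra hp
  exact pos i j (by simpa using hp) h

theorem mem_maxTensor_of_table {Φ : BiVec} (h : ∀ i j, 0 ≤ table Φ i j)
    (h1 : prodEffect unitEffect unitEffect Φ = 1) : Φ ∈ maxTensor 5 :=
  mem_maxTensor_iff.2 ⟨h, by rw [prodEffect_unitEffect] at h1; linarith⟩

theorem prodEffect_unitEffect_eq (Φ : BiVec) :
    prodEffect unitEffect unitEffect Φ = Φ 2 2 := by
  simp [prodEffect, unitEffect, mulVec, dotProduct, Fin.sum_univ_three]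

theorem phiJ_mem_maxTensor : phiJ ∈ maxTensor 5 :=
  mem_maxTensor_of_table (fun i j => table_phiJ i j ▸ (gram_nonneg _).1) <| by
    rw [prodEffect_unitEffect_eq]
    rfl

theorem phiH_mem_maxTensor : phiH ∈ maxTensor 5 :=
  mem_maxTensor_of_table (fun i j => table_phiH i j ▸ tableH_nonneg i j) <| by
    rw [prodEffect_unitEffect_eq]
    rfl

theorem phiP_mem_maxTensor : phiP ∈ maxTensor 5 :=
  mem_maxTensor_of_table
    (fun i j => table_phiP i j ▸ mul_nonneg (gram_nonneg _).1 (gram_nonneg _).1) <| by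
    simp [phiP, prodEffect_tensor, unitEffect, vertex_zero]

/-! ### The extreme states -/

theorem convex_maxTensor : Convex ℝ (maxTensor 5) := by
  intro Φ hΦ Ψ hΨ a b ha hb hab
  obtain ⟨h0, h1⟩ := mem_maxTensor_iff.1 hΦ
  obtain ⟨k0, k1⟩ := mem_maxTensor_iff.1 hΨ
  refine mem_maxTensor_iff.2 ⟨fun i j => ?_, ?_⟩
  · rw [table_add, table_smul, table_smul]
    exact add_nonneg (mul_nonneg ha (h0 i j)) (mul_nonneg hb (k0 i j))
  · simp only [table_add, table_smul, Finset.sum_add_distrib, ← Finset.mul_sum, h1, k1]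
    linear_combination 25 * hab

/-- An extreme state is determined by any state that vanishes wherever it does. -/
theorem eq_of_zeros_le {Φ Ψ : BiVec} (hΦ : Φ ∈ extremeStates 5) (hΨ : Ψ ∈ maxTensor 5)
    (h : zeros (table Φ) ≤ zeros (table Ψ)) : Φ = Ψ := by
  obtain ⟨h0, h1⟩ := mem_maxTensor_iff.1 hΦ.1
  obtain ⟨-, k1⟩ := mem_maxTensor_iff.1 hΨ
  rw [zeros_le_iff] at h
  -- Moving from Φ a little away from Ψ stays in the polytope: zero entries of Φ do not move, and
  -- positive entries have room. Then Φ is interior to a segment ending at Ψ, which extremality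
  -- forbids unless they coincide.
  have hev : ∀ᶠ t : ℝ in nhdsWithin 0 (Set.Ioi 0),
      ∀ i j, 0 ≤ table Φ i j + t * (table Φ i j - table Ψ i j) := by
    refine Filter.eventually_all.2 fun i => Filter.eventually_all.2 fun j => ?_
    rcases (h0 i j).eq_or_lt with e | e
    · exact Filter.Eventually.of_forall fun t => by rw [← e, h i j e.symm]; simp
    · have hc : Filter.Tendsto (fun t : ℝ => table Φ i j + t * (table Φ i j - table Ψ i j))
          (nhds 0) (nhds (table Φ i j + 0 * (table Φ i j - table Ψ i j))) :=
        Continuous.tendsto (by fun_prop) 0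
      rw [zero_mul, add_zero] at hc
      exact ((hc.eventually (lt_mem_nhds e)).mono fun t ht => ht.le).filter_mono nhdsWithin_le_nhds
  obtain ⟨t, ht, htpos⟩ := (hev.and self_mem_nhdsWithin).exists
  have htpos : 0 < t := htpos
  set Θ : BiVec := (1 + t) • Φ + (-t) • Ψ with hΘ
  have hmem : Θ ∈ maxTensor 5 := by
    refine mem_maxTensor_iff.2 ⟨fun i j => ?_, ?_⟩
    · rw [hΘ, table_add, table_smul, table_smul]
      linarith [ht i j]
    · simp only [hΘ, table_add, table_smul, Finset.sum_add_distrib, ← Finset.mul_sum, h1, k1]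
      ring
  have hseg : Φ ∈ openSegment ℝ Ψ Θ := by
    refine ⟨t / (1 + t), 1 / (1 + t), by positivity, by positivity, by field_simp; ring, ?_⟩
    have hne : (1 + t) ≠ 0 := by positivity
    rw [hΘ, smul_add, smul_smul, smul_smul, add_left_comm, ← add_smul]
    have e1 : 1 / (1 + t) * (1 + t) = 1 := by field_simp
    have e2 : t / (1 + t) + 1 / (1 + t) * -t = 0 := by ring
    rw [e1, e2, one_smul, zero_smul, add_zero]
  exact ((mem_extremePoints_iff_left.1 hΦ).2 Ψ hΨ Θ hmem hseg).symm

/-- The states in the local classes of the three representatives. -/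
def vertexStates : Set BiVec := localClass 5 phiP ∪ (localClass 5 phiJ ∪ localClass 5 phiH)

theorem vertexStates_subset : vertexStates ⊆ maxTensor 5 := by
  rintro Φ (h | h | h)
  · exact LocallyEquivalent.mem_maxTensor h phiP_mem_maxTensor
  · exact LocallyEquivalent.mem_maxTensor h phiJ_mem_maxTensor
  · exact LocallyEquivalent.mem_maxTensor h phiH_mem_maxTensor

theorem zeros_mem_extremePatterns {Φ : BiVec} (h : Φ ∈ vertexStates) :
    zeros (table Φ) ∈ extremePatterns := by
  rcases h with h | h | h
  · exact Or.inl (zeros_phiP ▸ LocallyEquivalent.zeros_mem_orbit h)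
  · exact Or.inr (Or.inl (zeros_phiJ ▸ LocallyEquivalent.zeros_mem_orbit h))
  · exact Or.inr (Or.inr (zeros_phiH ▸ LocallyEquivalent.zeros_mem_orbit h))

theorem exists_vertexState {y : Pattern} (hy : y ∈ extremePatterns) :
    ∃ Φ ∈ vertexStates, zeros (table Φ) = y := by
  rcases hy with h | h | h
  · obtain ⟨Φ, hΦ, e⟩ := exists_locallyEquivalent phiP (zeros_phiP.symm ▸ h)
    exact ⟨Φ, Or.inl hΦ, e⟩
  · obtain ⟨Φ, hΦ, e⟩ := exists_locallyEquivalent phiJ (zeros_phiJ.symm ▸ h)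
    exact ⟨Φ, Or.inr (Or.inl hΦ), e⟩
  · obtain ⟨Φ, hΦ, e⟩ := exists_locallyEquivalent phiH (zeros_phiH.symm ▸ h)
    exact ⟨Φ, Or.inr (Or.inr hΦ), e⟩

theorem extremeStates_subset : extremeStates 5 ⊆ vertexStates := by
  intro Φ hΦ
  obtain ⟨y, hy, hle⟩ := (saturated_zeros_table hΦ.1).exists_le
  obtain ⟨Ψ, hΨ, rfl⟩ := exists_vertexState hy
  exact eq_of_zeros_le hΦ (vertexStates_subset hΨ) hle ▸ hΨ

/-! ### Compactness, and existence of extreme states in faces. -/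

theorem continuous_table : Continuous tableLinear := tableLinear.continuous_of_finiteDimensional

theorem isClosed_setOf_table_eq (i j : Fin 5) (c : ℝ) : IsClosed {Φ : BiVec | table Φ i j = c} :=
  isClosed_eq ((continuous_apply j).comp ((continuous_apply i).comp continuous_table))
    continuous_const

/-- The table map is an injective linear map between finite-dimensional spaces, hence a closed
embedding, and nonnegative entries of total 25 lie in [0, 25]. -/
theorem isCompact_maxTensor : IsCompact (maxTensor 5) := by
  have hemb : Topology.IsClosedEmbedding tableLinear :=
    LinearMap.isClosedEmbedding_of_injective (LinearMap.ker_eq_bot.2 table_injective)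
  have hK : IsCompact (Set.Icc (0 : Fin 5 → Fin 5 → ℝ) fun _ _ => 25) := isCompact_Icc
  have hC : IsClosed {M : Fin 5 → Fin 5 → ℝ | ∑ i, ∑ j, M i j = 25} :=
    isClosed_eq (by fun_prop) continuous_const
  convert hemb.isCompact_preimage (hK.inter_right hC) using 1
  ext Φ
  rw [mem_maxTensor_iff]
  constructor
  · rintro ⟨h0, h1⟩
    refine ⟨⟨h0, fun i j => ?_⟩, h1⟩
    rw [← h1]
    exact (Finset.single_le_sum (f := fun j => table Φ i j) (fun j _ => h0 i j)
      (Finset.mem_univ j)).trans (Finset.single_le_sum (f := fun i => ∑ j, table Φ i j)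
      (fun i _ => Finset.sum_nonneg fun j _ => h0 i j) (Finset.mem_univ i))
  · rintro ⟨h0, h1⟩
    exact ⟨h0.1, h1⟩

instance : LocallyConvexSpace ℝ BiVec :=
  inferInstanceAs (LocallyConvexSpace ℝ (Fin 3 → Fin 3 → ℝ))

/-- Every state is dominated by an extreme state, in the sense of zero patterns. -/
theorem exists_extremeState {Φ : BiVec} (hΦ : Φ ∈ maxTensor 5) :
    ∃ Ψ ∈ extremeStates 5, zeros (table Φ) ≤ zeros (table Ψ) := by
  set F : Set BiVec := {Ψ | Ψ ∈ maxTensor 5 ∧ ∀ i j, table Φ i j = 0 → table Ψ i j = 0} with hF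
  have hclosed : IsClosed {Ψ : BiVec | ∀ i j, table Φ i j = 0 → table Ψ i j = 0} := by
    have e : {Ψ : BiVec | ∀ i j, table Φ i j = 0 → table Ψ i j = 0} =
        ⋂ i, ⋂ j, ⋂ _ : table Φ i j = 0, {Ψ | table Ψ i j = 0} := by
      ext Ψ
      simp
    rw [e]
    exact isClosed_iInter fun i => isClosed_iInter fun j => isClosed_iInter fun _ =>
      isClosed_setOf_table_eq i j 0
  have hcomp : IsCompact F := isCompact_maxTensor.inter_right hclosed
  -- `F` is a face: if a proper mixture of nonnegative entries is zero, so is each entry.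
  -- Krein–Milman gives an extreme point of `F`, which is then extreme in the whole set.
  have hext : IsExtreme ℝ (maxTensor 5) F := by
    refine ⟨fun Ψ h => h.1, ?_⟩
    rintro A hA B hB Ψ hΨ ⟨a, b, ha, hb, hab, rfl⟩
    refine ⟨hA, fun i j hij => ?_⟩
    have h0 := hΨ.2 i j hij
    rw [table_add, table_smul, table_smul] at h0
    have p := (mem_maxTensor_iff.1 hA).1 i j
    have q := mul_nonneg hb.le ((mem_maxTensor_iff.1 hB).1 i j)
    have p' := mul_nonneg ha.le p
    exact (mul_eq_zero.1 (show a * table A i j = 0 by linarith)).resolve_left ha.ne'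
  obtain ⟨Ψ, hΨ⟩ := hcomp.extremePoints_nonempty ⟨Φ, hΦ, fun _ _ h => h⟩
  exact ⟨Ψ, hext.extremePoints_subset_extremePoints hΨ, zeros_le_iff.2 hΨ.1.2⟩

/-- The codes of the zero patterns of all extreme states. -/
def codeList : List ℕ := codeListP ++ (codeListJ ++ codeListH)

/-- The known patterns form an antichain; this is what shows that none of the candidates is a proper
mixture. -/
theorem sub_codeList : (allOf codeList fun a => allOf codeList fun b =>
    implies (sub a b) (Nat.beq a b)) = true := by
  decide +kernel

theorem mem_allDih : ∀ g : Dih, g ∈ allDih := by decide +kernel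

theorem code_mem_codeListH (y : Pattern) (hy : y ∈ patH.orbit) : code y ∈ codeListH := by
  obtain ⟨g, h, rfl⟩ := hy
  rw [codeListH_eq]
  exact List.mem_map.2 ⟨(g, h), List.mem_product.2 ⟨mem_allDih g, mem_allDih h⟩, rfl⟩

theorem code_mem_codeListJ (y : Pattern) (hy : y ∈ patJ.orbit) : code y ∈ codeListJ := by
  obtain ⟨g, h, rfl⟩ := hy
  have : ∀ g h, code (patJ.pull g h) ∈ codeListJ := by decide +kernel
  exact this g h

theorem code_mem_codeListP (y : Pattern) (hy : y ∈ patP.orbit) : code y ∈ codeListP := by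
  obtain ⟨g, h, rfl⟩ := hy
  have : ∀ g h, code (patP.pull g h) ∈ codeListP := by decide +kernel
  exact this g h

theorem code_mem_codeList (y : Pattern) (hy : y ∈ extremePatterns) : code y ∈ codeList := by
  rcases hy with h | h | h
  · exact List.mem_append_left _ (code_mem_codeListP y h)
  · exact List.mem_append_right _ (List.mem_append_left _ (code_mem_codeListJ y h))
  · exact List.mem_append_right _ (List.mem_append_right _ (code_mem_codeListH y h))

theorem eq_of_le_of_mem_extremePatterns {y z : Pattern} (hy : y ∈ extremePatterns)
    (hz : z ∈ extremePatterns) (h : y ≤ z) : y = z :=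
  code_injective <| (iff_of_eq Nat.beq_eq).1 <| implies_iff.1
    (allOf_iff.1 (allOf_iff.1 sub_codeList _ (code_mem_codeList y hy)) _ (code_mem_codeList z hz))
    (sub_code_iff.2 h)

/-- A candidate has its zeros among those of some extreme state, which is again a candidate. By the
antichain property the patterns agree, and then so do the states. -/
theorem extremeStates_eq : extremeStates 5 = vertexStates := by
  refine extremeStates_subset.antisymm fun Φ hΦ => ?_
  obtain ⟨Ψ, hΨ, h⟩ := exists_extremeState (vertexStates_subset hΦ)
  have e := eq_of_le_of_mem_extremePatterns (zeros_mem_extremePatterns hΦ)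
    (zeros_mem_extremePatterns (extremeStates_subset hΨ)) h
  exact eq_of_zeros_le hΨ (vertexStates_subset hΦ) e.ge ▸ hΨ

/-! ### Product states -/

theorem stateSpace_induction {p : Vec → Prop} (hp : Convex ℝ {ω | p ω}) (h : ∀ i, p (vertex i))
    {ω : Vec} (hω : ω ∈ stateSpace 5) : p ω := by
  rw [stateSpace, image_pureState] at hω
  refine convexHull_min ?_ hp hω
  rintro _ ⟨i, rfl⟩
  exact h i

theorem vertex_dotProduct_nonneg (i : Fin 5) {ω : Vec} (hω : ω ∈ stateSpace 5) :
    0 ≤ vertex i ⬝ᵥ ω := by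
  refine stateSpace_induction (p := fun ω => 0 ≤ vertex i ⬝ᵥ ω) ?_ (fun j => ?_) hω
  · intro x hx y hy a b ha hb _
    change 0 ≤ vertex i ⬝ᵥ (a • x + b • y)
    rw [dotProduct_add, dotProduct_smul, dotProduct_smul]
    exact add_nonneg (mul_nonneg ha hx) (mul_nonneg hb hy)
  · rw [vertex_dotProduct_vertex]
    exact (gram_nonneg _).1

theorem unitEffect_dotProduct {ω : Vec} (hω : ω ∈ stateSpace 5) : unitEffect ⬝ᵥ ω = 1 := by
  refine stateSpace_induction (p := fun ω => unitEffect ⬝ᵥ ω = 1) ?_ (fun j => ?_) hω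
  · intro x hx y hy a b ha hb hab
    change unitEffect ⬝ᵥ (a • x + b • y) = 1
    rw [dotProduct_add, dotProduct_smul, dotProduct_smul, show unitEffect ⬝ᵥ x = 1 from hx,
      show unitEffect ⬝ᵥ y = 1 from hy]
    simpa using hab
  · rw [dotProduct_vertex]
    simp [unitEffect]

theorem productStates_subset : productStates 5 ⊆ maxTensor 5 := by
  rintro _ ⟨ω, hω, η, hη, rfl⟩
  refine mem_maxTensor_of_table (fun i j => ?_) ?_
  · rw [table_tensor]
    exact mul_nonneg (vertex_dotProduct_nonneg i hω) (vertex_dotProduct_nonneg j hη)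
  · rw [prodEffect_tensor, unitEffect_dotProduct hω, unitEffect_dotProduct hη, one_mul]

/-- An extreme state in the convex hull of the product states is an extreme point of that hull, and
these lie in the generating set; so for extreme states "not product" already means entangled. -/
theorem extremeStates_diff_productStates :
    extremeStates 5 \ productStates 5 = extremeEntangled 5 := by
  ext Φ
  refine and_congr_right fun hΦ => not_congr ⟨fun h => subset_convexHull ℝ _ h, fun h => ?_⟩
  exact extremePoints_convexHull_subset (inter_extremePoints_subset_extremePoints_of_subset
    (convexHull_min productStates_subset convex_maxTensor) ⟨h, hΦ⟩)

theorem gram_act : ∀ (g : Dih) (i : Fin 5), gram (act g i) = gram (i - g.1) := by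
  have h : ∀ i, gram (-i) = gram i := by
    intro i
    fin_cases i <;> rfl
  rintro ⟨k, b⟩ i
  cases b
  · change gram (k - i) = gram (i - k)
    rw [← h]
    exact congrArg gram (by revert k i; decide)
  · rfl

theorem localClass_phiP :
    localClass 5 phiP = {Φ | ∃ i j, Φ = tensor (vertex i) (vertex j)} := by
  ext Φ
  refine Iff.trans locallyEquivalent_iff ⟨?_, ?_⟩
  · rintro ⟨g, h, H⟩
    refine ⟨g.1, h.1, table_injective (funext fun i => funext fun j => ?_)⟩
    rw [H, table_phiP, table_tensor, gram_act, gram_act, vertex_dotProduct_vertex,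
      vertex_dotProduct_vertex]
  · rintro ⟨k, l, rfl⟩
    refine ⟨(k, true), (l, true), fun i j => ?_⟩
    rw [table_phiP, table_tensor, vertex_dotProduct_vertex, vertex_dotProduct_vertex, gram_act,
      gram_act]

theorem localClass_phiP_eq : localClass 5 phiP = {Φ | ∃ i ∈ Set.Icc 1 5, ∃ j ∈ Set.Icc 1 5,
    Φ = tensor (pureState 5 i) (pureState 5 j)} := by
  rw [localClass_phiP]
  have h1 : ∀ i, ∃ k ∈ Set.Icc 1 5, pureState 5 k = vertex i := fun i =>
    image_pureState.ge ⟨i, rfl⟩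
  have h2 : ∀ k ∈ Set.Icc 1 5, ∃ i, vertex i = pureState 5 k := fun k hk =>
    image_pureState.le ⟨k, hk, rfl⟩
  ext Φ
  constructor
  · rintro ⟨i, j, rfl⟩
    obtain ⟨k, hk, ek⟩ := h1 i
    obtain ⟨l, hl, el⟩ := h1 j
    exact ⟨k, hk, l, hl, by rw [ek, el]⟩
  · rintro ⟨k, hk, l, hl, rfl⟩
    obtain ⟨i, ei⟩ := h2 k hk
    obtain ⟨j, ej⟩ := h2 l hl
    exact ⟨i, j, by rw [ei, ej]⟩

theorem localClass_phiP_subset : localClass 5 phiP ⊆ productStates 5 := by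
  rw [localClass_phiP]
  rintro _ ⟨i, j, rfl⟩
  exact ⟨_, vertex_mem_stateSpace i, _, vertex_mem_stateSpace j, rfl⟩

/-- The table of a product state has the form x_i y_j, so a zero makes its whole row or its whole
column vanish; this survives permutations of rows and columns. -/
theorem not_mem_productStates {Φ Ψ : BiVec} {i i' j j' : Fin 5} (h : table Φ i j = 0)
    (hr : table Φ i j' ≠ 0) (hc : table Φ i' j ≠ 0) (hΨ : Ψ ∈ localClass 5 Φ) :
    Ψ ∉ productStates 5 := by
  rintro ⟨ω, -, η, -, rfl⟩
  obtain ⟨g, k, H⟩ := locallyEquivalent_iff.1 (equivalence_locallyEquivalent.symm hΨ)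
  simp only [table_tensor] at H
  rw [H] at h hr hc
  rcases mul_eq_zero.1 h with e | e
  · exact hr (by rw [e, zero_mul])
  · exact hc (by rw [e, mul_zero])

theorem localClass_phiJ_disjoint {Φ : BiVec} (h : Φ ∈ localClass 5 phiJ) : Φ ∉ productStates 5 := by
  have z {i j : Fin 5} : table phiJ i j = 0 ↔ patJ i j = true := by rw [← zeros_phiJ, zeros_iff]
  exact not_mem_productStates (i := 0) (j := 2) (i' := 2) (j' := 0) (z.2 (by decide))
    (mt z.1 (by decide)) (mt z.1 (by decide)) h

theorem localClass_phiH_disjoint {Φ : BiVec} (h : Φ ∈ localClass 5 phiH) : Φ ∉ productStates 5 := by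
  have z {i j : Fin 5} : table phiH i j = 0 ↔ patH i j = true := by rw [← zeros_phiH, zeros_iff]
  exact not_mem_productStates (i := 0) (j := 0) (i' := 2) (j' := 2) (z.2 (by decide))
    (mt z.1 (by decide)) (mt z.1 (by decide)) h

theorem extremeStates_inter_productStates :
    extremeStates 5 ∩ productStates 5 = localClass 5 phiP := by
  rw [extremeStates_eq]
  refine Set.Subset.antisymm ?_ fun Φ h => ⟨Or.inl h, localClass_phiP_subset h⟩
  rintro Φ ⟨h | h | h, hp⟩
  · exact h
  · exact absurd hp (localClass_phiJ_disjoint h)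
  · exact absurd hp (localClass_phiH_disjoint h)

theorem extremeEntangled_eq :
    extremeEntangled 5 = localClass 5 phiJ ∪ localClass 5 phiH := by
  rw [← extremeStates_diff_productStates, extremeStates_eq]
  refine Set.Subset.antisymm ?_ ?_
  · rintro Φ ⟨h | h, hp⟩
    · exact absurd (localClass_phiP_subset h) hp
    · exact h
  · rintro Φ (h | h)
    · exact ⟨Or.inr (Or.inl h), localClass_phiJ_disjoint h⟩
    · exact ⟨Or.inr (Or.inr h), localClass_phiH_disjoint h⟩

/-! ### Counting -/

/-- Extreme states are determined by their zero patterns, so the class is in bijection with the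
orbit of its pattern, listed without repetition by `l`. -/
theorem ncard_localClass {Φ : BiVec} (hΦ : localClass 5 Φ ⊆ extremeStates 5) {l : List ℕ}
    (hl : l.Nodup) (h : ∀ y ∈ (zeros (table Φ)).orbit, code y ∈ l)
    (h' : ∀ n ∈ l, ∃ y ∈ (zeros (table Φ)).orbit, code y = n) :
    (localClass 5 Φ).ncard = l.length := by
  have hinj : Set.InjOn (fun Ψ => code (zeros (table Ψ))) (localClass 5 Φ) := fun Ψ hΨ Θ hΘ e =>
    eq_of_zeros_le (hΦ hΨ) (hΦ hΘ).1 (code_injective e).le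
  rw [← hinj.ncard_image, ← List.toFinset_card_of_nodup hl, ← Set.ncard_coe_finset]
  congr 1
  ext n
  rw [List.coe_toFinset, Set.mem_ofPred_eq]
  constructor
  · rintro ⟨Ψ, hΨ, rfl⟩
    exact h _ (LocallyEquivalent.zeros_mem_orbit hΨ)
  · intro hn
    obtain ⟨y, hy, rfl⟩ := h' n hn
    obtain ⟨Ψ, hΨ, rfl⟩ := exists_locallyEquivalent Φ hy
    exact ⟨Ψ, hΨ, rfl⟩

theorem ncard_localClass_phiP : (localClass 5 phiP).ncard = 25 := by
  refine ncard_localClass (l := codeListP) (extremeStates_eq ▸ fun _ h => Or.inl h)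
    (by decide +kernel) (zeros_phiP ▸ code_mem_codeListP) fun n hn => ?_
  rw [codeListP_eq, List.mem_map] at hn
  obtain ⟨p, -, rfl⟩ := hn
  exact ⟨_, zeros_phiP ▸ ⟨_, _, rfl⟩, rfl⟩

theorem ncard_localClass_phiJ : (localClass 5 phiJ).ncard = 10 := by
  refine ncard_localClass (l := codeListJ) (extremeStates_eq ▸ fun _ h => Or.inr (Or.inl h))
    (by decide +kernel) (zeros_phiJ ▸ code_mem_codeListJ) fun n hn => ?_
  rw [codeListJ_eq, List.mem_map] at hn
  obtain ⟨p, -, rfl⟩ := hn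
  exact ⟨_, zeros_phiJ ▸ ⟨_, _, rfl⟩, rfl⟩

theorem ncard_localClass_phiH : (localClass 5 phiH).ncard = 100 := by
  refine ncard_localClass (l := codeListH) (extremeStates_eq ▸ fun _ h => Or.inr (Or.inr h))
    (by decide +kernel) (zeros_phiH ▸ code_mem_codeListH) fun n hn => ?_
  rw [codeListH_eq, List.mem_map] at hn
  obtain ⟨p, -, rfl⟩ := hn
  exact ⟨_, zeros_phiH ▸ ⟨_, _, rfl⟩, rfl⟩

theorem not_locallyEquivalent_phiJ_phiH : ¬ LocallyEquivalent 5 phiJ phiH := by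
  intro h
  have h1 := code_mem_codeListJ _ (zeros_phiJ ▸ h.zeros_mem_orbit)
  rw [zeros_phiH] at h1
  exact absurd h1 (by decide +kernel)

theorem mem_localClass_self (Φ : BiVec) : Φ ∈ localClass 5 Φ :=
  equivalence_locallyEquivalent.refl Φ

theorem ncard_extremeEntangled : (extremeEntangled 5).ncard = 110 := by
  have hfin {Φ : BiVec} {n : ℕ} (h : (localClass 5 Φ).ncard = n + 1) : (localClass 5 Φ).Finite :=
    Set.finite_of_ncard_ne_zero (by rw [h]; exact n.succ_ne_zero)
  rw [extremeEntangled_eq, Set.ncard_union_eq ?_ (hfin ncard_localClass_phiJ)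
    (hfin ncard_localClass_phiH), ncard_localClass_phiJ, ncard_localClass_phiH]
  refine Set.disjoint_left.2 fun Φ hJ hH => not_locallyEquivalent_phiJ_phiH ?_
  exact equivalence_locallyEquivalent.trans hJ (equivalence_locallyEquivalent.symm hH)

theorem ncard_extremeStates : (extremeStates 5).ncard = 135 := by
  have h1 : (extremeStates 5 ∩ productStates 5).ncard = 25 := by
    rw [extremeStates_inter_productStates, ncard_localClass_phiP]
  have h2 : (extremeStates 5 \ productStates 5).ncard = 110 := by
    rw [extremeStates_diff_productStates, ncard_extremeEntangled]
  rw [← Set.inter_union_sdiff (extremeStates 5) (productStates 5), Set.ncard_union_eq ?_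
    (Set.finite_of_ncard_ne_zero (by rw [h1]; decide))
    (Set.finite_of_ncard_ne_zero (by rw [h2]; decide)), h1, h2]
  exact Set.disjoint_sdiff_right.mono_left Set.inter_subset_right

end Polygon

end

theorem mainTheorem3 :
    -- the extreme normalized states
    (Polygon.extremeStates 5).ncard = 135 ∧
    -- the product ones among them
    Polygon.extremeStates 5 ∩ Polygon.productStates 5 =
      {Φ | ∃ i ∈ Set.Icc 1 5, ∃ j ∈ Set.Icc 1 5,
        Φ = Polygon.tensor (Polygon.pureState 5 i) (Polygon.pureState 5 j)} ∧
    (Polygon.extremeStates 5 ∩ Polygon.productStates 5).ncard = 25 ∧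
    -- all the others are entangled
    Polygon.extremeStates 5 \ Polygon.productStates 5 = Polygon.extremeEntangled 5 ∧
    (Polygon.extremeEntangled 5).ncard = 110 ∧
    -- the classes of extreme entangled states under local reversible transformations
    Equivalence (Polygon.LocallyEquivalent 5) ∧
    Polygon.phiJ ∈ Polygon.extremeEntangled 5 ∧
    Polygon.phiH ∈ Polygon.extremeEntangled 5 ∧
    ¬ Polygon.LocallyEquivalent 5 Polygon.phiJ Polygon.phiH ∧
    Polygon.extremeEntangled 5 =
      Polygon.localClass 5 Polygon.phiJ ∪ Polygon.localClass 5 Polygon.phiH ∧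
    (Polygon.localClass 5 Polygon.phiJ).ncard = 10 ∧
    (Polygon.localClass 5 Polygon.phiH).ncard = 100 := by
  refine ⟨Polygon.ncard_extremeStates, ?_, ?_, Polygon.extremeStates_diff_productStates,
    Polygon.ncard_extremeEntangled, Polygon.equivalence_locallyEquivalent, ?_, ?_,
    Polygon.not_locallyEquivalent_phiJ_phiH, Polygon.extremeEntangled_eq,
    Polygon.ncard_localClass_phiJ, Polygon.ncard_localClass_phiH⟩
  · rw [Polygon.extremeStates_inter_productStates, Polygon.localClass_phiP_eq]
  · rw [Polygon.extremeStates_inter_productStates, Polygon.ncard_localClass_phiP]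
  · rw [Polygon.extremeEntangled_eq]
    exact Or.inl (Polygon.mem_localClass_self _)
  · rw [Polygon.extremeEntangled_eq]
    exact Or.inr (Polygon.mem_localClass_self _)
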